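/- Let the integers $g_1(n)$, $n\ge 0$, be defined by the expansion $$\sum_{n=0}^{\infty} g_1(n)q^n = (-q;q^5)_\infty^2\,(-q^4;q^5)_\infty^2\,(q^4;q^{10})_\infty\,(q^6;q^{10})_\infty,\qquad (a;q)_\infty:=\prod_{k=0}^{\infty}(1-aq^k),$$ as formal power series in $q$. Then for every integer $n\ge 0$: $$g_1(5n)>0,\qquad g_1(5n+1)>0,\qquad g_1(5n+2)>0,$$ and $g_1(5n+4)>0$ if and only if $n\ne 1$. -/

import Mathlib

open scoped PowerSeries PowerSeries.WithPiTopology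

/-- The `q`-shifted factorial `(a; q)_∞ = ∏_{n ≥ 0} (1 - a q ^ n)` for formal power series `a`, `q`
with integer coefficients. The product converges coefficientwise (`ℤ` is discrete) whenever `q` has
zero constant term, see `multipliable_qPochhammerInf`. -/
noncomputable def qPochhammerInf (a q : ℤ⟦X⟧) : ℤ⟦X⟧ :=
  ∏' n : ℕ, (1 - a * q ^ n)

/-- The infinite product defining `(a; q)_∞` converges if `q` has zero constant term. -/
theorem multipliable_qPochhammerInf (a q : ℤ⟦X⟧) (hq : PowerSeries.constantCoeff q = 0) :
    Multipliable (fun n : ℕ => 1 - a * q ^ n) := by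
  simp_rw [sub_eq_add_neg]
  apply PowerSeries.WithPiTopology.multipliable_one_add_of_tendsto_order_atTop_nhds_top
  refine ENat.tendsto_nhds_top_iff_natCast_lt.mpr
    (fun n => Filter.eventually_atTop.mpr ⟨n + 1, fun m hm => ?_⟩)
  rw [PowerSeries.order_neg]
  have h1 : (m : ℕ∞) ≤ (a * q ^ m).order := by
    refine PowerSeries.nat_le_order _ _ (fun i hi => ?_)
    have hX : (PowerSeries.X : ℤ⟦X⟧) ^ m ∣ a * q ^ m :=
      Dvd.dvd.mul_left (pow_dvd_pow_of_dvd (PowerSeries.X_dvd_iff.mpr hq) m) a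
    exact PowerSeries.X_pow_dvd_iff.mp hX i hi
  refine lt_of_lt_of_le ?_ h1
  exact_mod_cast hm

/-- The generating function `(-q, -q⁴; q⁵)_∞² (q⁴, q⁶; q¹⁰)_∞`, where `q` is the formal variable and
`(a, b; q)_∞ = (a; q)_∞ (b; q)_∞`. -/
noncomputable def g₁Series : ℤ⟦X⟧ :=
  let q : ℤ⟦X⟧ := PowerSeries.X
  (qPochhammerInf (-q) (q ^ 5) * qPochhammerInf (-q ^ 4) (q ^ 5)) ^ 2 *
    (qPochhammerInf (q ^ 4) (q ^ 10) * qPochhammerInf (q ^ 6) (q ^ 10))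

/-- `g₁ n` is the coefficient of `q ^ n` in `(-q, -q⁴; q⁵)_∞² (q⁴, q⁶; q¹⁰)_∞`. -/
noncomputable def g₁ (n : ℕ) : ℤ :=
  PowerSeries.coeff n g₁Series

/-! Write f(x, y) = ∑ x^(n(n+1)/2) y^(n(n-1)/2) over n ∈ ℤ, and E_k = (q^k; q^k)_∞. By the Jacobi
triple product (`thetaSeries_eq_qPochhammerInf`), multiplying the generating function by E_5² E_10,
a series in q⁵, gives f(q, q⁴)² f(-q⁶, -q⁴).

This product is dissected modulo 5 by splitting double theta sums over cosets of sublattices of ℤ²: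
index 2 for the square, then index 5 for each product with f(-q⁶, -q⁴). No exponent ≡ 3 mod 5
survives. After q⁵ ↦ q, each remaining class contains a bracket of two theta products
(`thetaSeries_sq_mul_eq_dilate`). The bracket is one double sum over a form 3x² ± 4xy + 3y²;
resumming it by a coordinate modulo 3 pulls out E_1 = f(-q, -q²) (`thetaSeries_bracket_zero`,
`thetaSeries_bracket_one`, `thetaSeries_bracket_four`). The cofactor is 2E_5 in class 1, and in the
other classes a quintuple product (`thetaSeries_quintuple_one_four`,
`thetaSeries_quintuple_two_three`).

After cancelling E_1² E_2, the classes 0, 1, 2, 4 are 1 or 2 divided by a product of factors 1 - q^d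
(`exists_dissection`). Such quotients have nonnegative coefficients. In classes 0, 1, 2 the factor 1
- q occurs, so every coefficient is positive. In class 4 the factors 1 - q² and 1 - q³ occur but 1 -
q does not, and every n ≥ 0 except 1 is a sum of 2s and 3s. -/

/-! ### Signed monomials and theta series -/

/-- Open ideals form a basis at 0. In this setting a family is summable once its terms tend to 0,
and a product of two sums is a double sum. -/
instance PowerSeries.WithPiTopology.nonarchimedeanRing_int : NonarchimedeanRing ℤ⟦X⟧ where
  is_nonarchimedean := by
    intro U hU
    have : IsLinearTopology ℤ⟦X⟧ ℤ⟦X⟧ :=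
      inferInstanceAs (IsLinearTopology (MvPowerSeries Unit ℤ) (MvPowerSeries Unit ℤ))
    obtain ⟨I, hI, hIU⟩ := (IsLinearTopology.hasBasis_open_ideal (R := ℤ⟦X⟧)).mem_iff.mp hU
    exact ⟨⟨I.toAddSubgroup, hI⟩, hIU⟩

/-- The signed monomial `(-1) ^ k * q ^ (P / 2)`. -/
noncomputable def qMono (k P : ℤ) : ℤ⟦X⟧ :=
  PowerSeries.monomial (P / 2).toNat (k.negOnePow : ℤ)

theorem qMono_congr {k k' P P' : ℤ} (hk : (k - k') % 2 = 0) (hP : P = P') :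
    qMono k P = qMono k' P' := by
  rw [qMono, qMono, hP, (Int.negOnePow_eq_iff k k').mpr (Int.even_iff.mpr hk)]

/-- Exponents are carried doubled so that the quadratic polynomials have integer coefficients;
halving is additive once one summand is even. -/
theorem qMono_mul_qMono (k k' : ℤ) {P P' : ℤ} (hP : 0 ≤ P) (hP' : 0 ≤ P') (h : P % 2 = 0) :
    qMono k P * qMono k' P' = qMono (k + k') (P + P') := by
  rw [qMono, qMono, qMono, PowerSeries.monomial_mul_monomial, Int.negOnePow_add]
  congr 2
  omega

theorem qMono_zero_left (e : ℕ) : qMono 0 (2 * e) = PowerSeries.X ^ e := by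
  rw [qMono, PowerSeries.X_pow_eq]
  simp

theorem qMono_one_left (e : ℕ) : qMono 1 (2 * e) = -PowerSeries.X ^ e := by
  rw [qMono, PowerSeries.X_pow_eq, ← map_neg]
  simp

theorem qMono_succ (k P : ℤ) : qMono (k + 1) P = -qMono k P := by
  rw [qMono, qMono, ← map_neg]
  simp [Int.negOnePow_succ]

/-- Twice the exponent of the `n`-th term of a theta series. -/
def thetaExp (a b : ℕ) (n : ℤ) : ℤ := (a + b) * n ^ 2 + (a - b) * n

theorem thetaExp_eq (a b : ℕ) (n : ℤ) : thetaExp a b n = a * (n * (n + 1)) + b * (n * (n - 1)) := by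
  rw [thetaExp]; ring

theorem mul_add_one_nonneg (n : ℤ) : 0 ≤ n * (n + 1) := by
  rcases le_or_gt 0 n with h | h <;> nlinarith

theorem mul_sub_one_nonneg (n : ℤ) : 0 ≤ n * (n - 1) := by
  rcases le_or_gt n 0 with h | h <;> nlinarith

theorem thetaExp_nonneg (a b : ℕ) (n : ℤ) : 0 ≤ thetaExp a b n := by
  rw [thetaExp_eq]
  have h1 := mul_add_one_nonneg n
  have h2 := mul_sub_one_nonneg n
  positivity

theorem thetaExp_emod_two (a b : ℕ) (n : ℤ) : thetaExp a b n % 2 = 0 := by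
  rw [← Int.even_iff, thetaExp_eq]
  exact (Int.even_mul_succ_self n).mul_left _ |>.add ((Int.even_mul_pred_self n).mul_left _)

/-- Linear growth leaves finitely many terms in each degree. One positive parameter suffices, which
admits the degenerate series with `b = 0`; the `+ 1` covers n = ±1, where one of n(n+1), n(n-1)
vanishes. -/
theorem natAbs_le_thetaExp {a b : ℕ} (h : 0 < a + b) (n : ℤ) : n.natAbs ≤ thetaExp a b n + 1 := by
  have h1 := mul_add_one_nonneg n
  have h2 := mul_sub_one_nonneg n
  have key : (n.natAbs : ℤ) ≤ n * (n + 1) + 1 ∧ (n.natAbs : ℤ) ≤ n * (n - 1) + 1 := by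
    rw [Int.natCast_natAbs]
    constructor <;> rcases abs_cases n with ⟨h, _⟩ | ⟨h, _⟩ <;> rw [h] <;> nlinarith
  rw [thetaExp_eq]
  rcases Nat.eq_zero_or_pos a with ha | ha
  · have : (1 : ℤ) ≤ b := by omega
    nlinarith [mul_nonneg (Int.natCast_nonneg a) h1]
  · have : (1 : ℤ) ≤ a := by omega
    nlinarith [mul_nonneg (Int.natCast_nonneg b) h2]

/-- Ramanujan's theta function `∑ₙ (εq^a)^(n(n+1)/2) (εq^b)^(n(n-1)/2)` with `ε = (-1) ^ s`. -/
noncomputable def thetaSeries (s : ℤ) (a b : ℕ) : ℤ⟦X⟧ :=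
  ∑' n : ℤ, qMono (s * n) (thetaExp a b n)

theorem tendsto_of_finite_coeff {ι : Type*} {f : ι → ℤ⟦X⟧}
    (h : ∀ d, {i | PowerSeries.coeff d (f i) ≠ 0}.Finite) :
    Filter.Tendsto f Filter.cofinite (nhds 0) := by
  rw [PowerSeries.WithPiTopology.tendsto_iff_coeff_tendsto]
  intro d
  apply tendsto_nhds_of_eventually_eq
  simpa [Filter.eventually_cofinite] using h d

theorem summable_thetaSeries {a b : ℕ} (h : 0 < a + b) (s : ℤ) :
    Summable fun n : ℤ => qMono (s * n) (thetaExp a b n) := by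
  apply NonarchimedeanAddGroup.summable_of_tendsto_cofinite_zero
  apply tendsto_of_finite_coeff
  intro d
  refine (Set.finite_Icc (-(2 * d + 1 : ℤ)) (2 * d + 1)).subset fun n hn => ?_
  have hd : d = (thetaExp a b n / 2).toNat := by
    by_contra hne
    exact hn (by rw [qMono, PowerSeries.coeff_monomial, if_neg hne])
  have h1 := natAbs_le_thetaExp h n
  have h2 := thetaExp_nonneg a b n
  have h3 := thetaExp_emod_two a b n
  rw [Set.mem_Icc]
  omega

theorem hasSum_thetaSeries {a b : ℕ} (h : 0 < a + b) (s : ℤ) :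
    HasSum (fun n : ℤ => qMono (s * n) (thetaExp a b n)) (thetaSeries s a b) :=
  (summable_thetaSeries h s).hasSum

/-- A double series whose terms factor is a product of two theta series. -/
theorem hasSum_thetaSeries_mul {κ P : ℤ → ℤ → ℤ} (k : ℤ) (e : ℕ) (s : ℤ) (a b : ℕ) (t : ℤ) (c d : ℕ)
    (hκ : ∀ m n, (κ m n - (k + s * m + t * n)) % 2 = 0)
    (hP : ∀ m n, P m n = 2 * e + ((a + b) * m ^ 2 + (a - b) * m) + ((c + d) * n ^ 2 + (c - d) * n))
    (hab : 0 < a + b := by norm_num) (hcd : 0 < c + d := by norm_num) :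
    HasSum (fun p : ℤ × ℤ => qMono (κ p.1 p.2) (P p.1 p.2))
      (qMono k (2 * e) * (thetaSeries s a b * thetaSeries t c d)) := by
  have h := ((hasSum_thetaSeries hab s).mul_of_nonarchimedean
    (hasSum_thetaSeries hcd t)).mul_left (qMono k (2 * e))
  refine h.congr_fun fun p => ?_
  have h1 := thetaExp_nonneg a b p.1
  have h2 := thetaExp_nonneg c d p.2
  have h3 := thetaExp_emod_two a b p.1
  rw [qMono_mul_qMono _ _ h1 h2 h3, qMono_mul_qMono _ _ (by positivity) (by positivity) (by omega)]
  refine qMono_congr ?_ ?_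
  · rw [← add_assoc]; exact hκ p.1 p.2
  · rw [hP, thetaExp, thetaExp]; ring

/-! ### Double series split over cosets -/

/-- The points of `ℤ × ℤ` where `ρ` takes the value `c` are parametrized by `(α, β)`, with inverse
`(μ, ν)`. -/
structure IsCosetParam (ρ : ℤ → ℤ → ℤ) (c : ℤ) (α β μ ν : ℤ → ℤ → ℤ) : Prop where
  left : ∀ m n, ρ (α m n) (β m n) = c ∧ μ (α m n) (β m n) = m ∧ ν (α m n) (β m n) = n
  right : ∀ x y, ρ x y = c → α (μ x y) (ν x y) = x ∧ β (μ x y) (ν x y) = y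

namespace IsCosetParam

variable {ρ α β μ ν : ℤ → ℤ → ℤ} {c : ℤ}

theorem injective (h : IsCosetParam ρ c α β μ ν) :
    Function.Injective fun p : ℤ × ℤ => (α p.1 p.2, β p.1 p.2) := by
  intro p q hpq
  have h1 := congrArg Prod.fst hpq
  have h2 := congrArg Prod.snd hpq
  simp only at h1 h2
  obtain ⟨-, h3, h4⟩ := h.left p.1 p.2
  obtain ⟨-, h5, h6⟩ := h.left q.1 q.2
  rw [h1, h2, h5] at h3
  rw [h1, h2, h6] at h4
  exact Prod.ext h3.symm h4.symm

theorem hasSum (h : IsCosetParam ρ c α β μ ν) {F : ℤ × ℤ → ℤ⟦X⟧} {S : ℤ⟦X⟧}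
    (hF : HasSum (fun p : ℤ × ℤ => F (α p.1 p.2, β p.1 p.2)) S) :
    HasSum (fun p : ℤ × ℤ => if ρ p.1 p.2 = c then F p else 0) S := by
  rw [← h.injective.hasSum_iff]
  · refine hF.congr_fun fun p => ?_
    simp only [Function.comp_apply]
    rw [if_pos (h.left p.1 p.2).1]
  · rintro ⟨x, y⟩ hxy
    refine if_neg fun hc => hxy ⟨(μ x y, ν x y), ?_⟩
    exact Prod.ext (h.right x y hc).1 (h.right x y hc).2

/-- For pieces that are only compared with one another and never evaluated as theta products. -/
theorem hasSum_tsum (h : IsCosetParam ρ c α β μ ν) {F : ℤ × ℤ → ℤ⟦X⟧} (hF : Summable F) :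
    HasSum (fun p : ℤ × ℤ => if ρ p.1 p.2 = c then F p else 0)
      (∑' p : ℤ × ℤ, F (α p.1 p.2, β p.1 p.2)) :=
  h.hasSum (hF.comp_injective h.injective).hasSum

/-- For parametrizations that diagonalize the quadratic form: the piece is then again a product of
two theta series. -/
theorem hasSum_qMono (h : IsCosetParam ρ c α β μ ν) (κ P : ℤ → ℤ → ℤ) (k : ℤ) (e : ℕ)
    (s : ℤ) (a b : ℕ) (t : ℤ) (a' b' : ℕ)
    (hκ : ∀ m n, (κ (α m n) (β m n) - (k + s * m + t * n)) % 2 = 0)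
    (hP : ∀ m n, P (α m n) (β m n) =
      2 * e + ((a + b) * m ^ 2 + (a - b) * m) + ((a' + b') * n ^ 2 + (a' - b') * n))
    (hab : 0 < a + b := by norm_num) (hcd : 0 < a' + b' := by norm_num) :
    HasSum (fun p : ℤ × ℤ => if ρ p.1 p.2 = c then qMono (κ p.1 p.2) (P p.1 p.2) else 0)
      (qMono k (2 * e) * (thetaSeries s a b * thetaSeries t a' b')) :=
  h.hasSum (F := fun p => qMono (κ p.1 p.2) (P p.1 p.2))
    (hasSum_thetaSeries_mul (κ := fun m n => κ (α m n) (β m n)) (P := fun m n => P (α m n) (β m n))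
      k e s a b t a' b' hκ hP hab hcd)

end IsCosetParam

section Residues

variable {ρ : ℤ → ℤ → ℤ} {F : ℤ × ℤ → ℤ⟦X⟧} {S₀ S₁ S₂ S₃ S₄ : ℤ⟦X⟧}

theorem hasSum_of_two_residues (hρ : ∀ x y, ρ x y = 0 ∨ ρ x y = 1)
    (h₀ : HasSum (fun p => if ρ p.1 p.2 = 0 then F p else 0) S₀)
    (h₁ : HasSum (fun p => if ρ p.1 p.2 = 1 then F p else 0) S₁) : HasSum F (S₀ + S₁) := by
  refine (h₀.add h₁).congr_fun fun p => ?_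
  rcases hρ p.1 p.2 with h | h <;> simp [h]

theorem hasSum_of_three_residues (hρ : ∀ x y, ρ x y = 0 ∨ ρ x y = 1 ∨ ρ x y = 2)
    (h₀ : HasSum (fun p => if ρ p.1 p.2 = 0 then F p else 0) S₀)
    (h₁ : HasSum (fun p => if ρ p.1 p.2 = 1 then F p else 0) S₁)
    (h₂ : HasSum (fun p => if ρ p.1 p.2 = 2 then F p else 0) S₂) : HasSum F (S₀ + S₁ + S₂) := by
  refine ((h₀.add h₁).add h₂).congr_fun fun p => ?_
  rcases hρ p.1 p.2 with h | h | h <;> simp [h]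

theorem hasSum_of_five_residues
    (hρ : ∀ x y, ρ x y = 0 ∨ ρ x y = 1 ∨ ρ x y = 2 ∨ ρ x y = 3 ∨ ρ x y = 4)
    (h₀ : HasSum (fun p => if ρ p.1 p.2 = 0 then F p else 0) S₀)
    (h₁ : HasSum (fun p => if ρ p.1 p.2 = 1 then F p else 0) S₁)
    (h₂ : HasSum (fun p => if ρ p.1 p.2 = 2 then F p else 0) S₂)
    (h₃ : HasSum (fun p => if ρ p.1 p.2 = 3 then F p else 0) S₃)
    (h₄ : HasSum (fun p => if ρ p.1 p.2 = 4 then F p else 0) S₄) :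
    HasSum F (S₀ + S₁ + S₂ + S₃ + S₄) := by
  refine ((((h₀.add h₁).add h₂).add h₃).add h₄).congr_fun fun p => ?_
  rcases hρ p.1 p.2 with h | h | h | h | h <;> simp [h]

end Residues

theorem thetaSeries_comm (s : ℤ) (a b : ℕ) : thetaSeries s a b = thetaSeries s b a := by
  rw [thetaSeries, ← (Equiv.neg ℤ).tsum_eq, thetaSeries]
  refine tsum_congr fun n => qMono_congr ?_ ?_
  · simp only [Equiv.neg_apply]
    rw [← Int.even_iff]
    exact ⟨-(s * n), by ring⟩
  · simp only [Equiv.neg_apply, thetaExp]; ring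

/-- The reflection n ↦ -n - 1 fixes the exponent and flips the sign, so the series equals its own
negative. -/
theorem thetaSeries_one_zero_right (a : ℕ) : thetaSeries 1 a 0 = 0 := by
  have h : thetaSeries 1 a 0 = -thetaSeries 1 a 0 := by
    conv_lhs => rw [thetaSeries, ← ((Equiv.neg ℤ).trans (Equiv.addRight (-1))).tsum_eq]
    rw [thetaSeries, ← tsum_neg]
    refine tsum_congr fun n => ?_
    rw [← qMono_succ]
    refine qMono_congr ?_ ?_
    · simp; omega
    · simp [thetaExp]; ring
  ext d
  have hd := congrArg (PowerSeries.coeff d) h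
  rw [map_neg] at hd
  rw [map_zero]
  omega

/-! ### Rearrangements of products of two theta series -/

theorem isCosetParam_even :
    IsCosetParam (fun x y => (x + y) % 2) 0 (fun u v => u + v) (fun u v => u - v)
      (fun x y => (x + y) / 2) (fun x y => (x - y) / 2) := by
  constructor <;> intros <;> omega

/-- This and the next two variants describe the same coset; the place of the offset 1 decides which
linear terms, hence which theta parameters, come out. -/
theorem isCosetParam_odd :
    IsCosetParam (fun x y => (x + y) % 2) 1 (fun u v => u + v + 1) (fun u v => u - v)
      (fun x y => (x + y) / 2) (fun x y => (x - y) / 2) := by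
  constructor <;> intros <;> omega

theorem isCosetParam_odd_rev :
    IsCosetParam (fun x y => (x + y) % 2) 1 (fun u v => u - v) (fun u v => u + v + 1)
      (fun x y => (x + y) / 2) (fun x y => (y - x) / 2) := by
  constructor <;> intros <;> omega

theorem isCosetParam_odd_right :
    IsCosetParam (fun x y => (x + y) % 2) 1 (fun u v => u + v) (fun u v => u - v + 1)
      (fun x y => (x + y) / 2) (fun x y => (x - y + 1) / 2) := by
  constructor <;> intros <;> omega

theorem thetaSeries_sq_one_four :
    thetaSeries 0 1 4 ^ 2 = thetaSeries 0 2 8 * thetaSeries 0 5 5 +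
      PowerSeries.X * (thetaSeries 0 7 3 * thetaSeries 0 10 0) := by
  let κ : ℤ → ℤ → ℤ := fun _ _ => 0
  let P : ℤ → ℤ → ℤ := fun x y => 5 * x ^ 2 - 3 * x + (5 * y ^ 2 - 3 * y)
  have hL := hasSum_thetaSeries_mul (κ := κ) (P := P) 0 0 0 1 4 0 1 4
    (by intros; simp only [κ]; omega) (by intros; simp only [P]; push_cast; ring)
  have hR0 := isCosetParam_even.hasSum_qMono κ P 0 0 0 2 8 0 5 5
    (by intros; simp only [κ]; omega) (by intros; simp only [P]; push_cast; ring)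
  have hR1 := isCosetParam_odd.hasSum_qMono κ P 0 1 0 7 3 0 10 0
    (by intros; simp only [κ]; omega) (by intros; simp only [P]; push_cast; ring)
  have hR := hasSum_of_two_residues (ρ := fun x y => (x + y) % 2)
    (F := fun p => qMono (κ p.1 p.2) (P p.1 p.2)) (fun x y => by omega) hR0 hR1
  have h := hL.unique hR
  simp only [qMono_zero_left] at h
  linear_combination h

/-! ### Splitting two theta products modulo 5 -/

/-- The lattice has the orthogonal basis (1, 2), (-2, 1) of norm 5 (multiplication by 1 + 2i), so x²
+ y² becomes 5(u² + v²). The other cosets are unit shifts of it. -/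
theorem isCosetParam_threeOne_zero :
    IsCosetParam (fun x y => (3 * x + y) % 5) 0 (fun u v => u - 2 * v) (fun u v => 2 * u + v)
      (fun x y => (x + 2 * y) / 5) (fun x y => (y - 2 * x) / 5) := by
  constructor <;> intros <;> omega

theorem isCosetParam_threeOne_one :
    IsCosetParam (fun x y => (3 * x + y) % 5) 1 (fun u v => u - 2 * v) (fun u v => 2 * u + v + 1)
      (fun x y => (x + 2 * (y - 1)) / 5) (fun x y => ((y - 1) - 2 * x) / 5) := by
  constructor <;> intros <;> omega

theorem isCosetParam_threeOne_two :
    IsCosetParam (fun x y => (3 * x + y) % 5) 2 (fun u v => u - 2 * v - 1) (fun u v => 2 * u + v)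
      (fun x y => ((x + 1) + 2 * y) / 5) (fun x y => (y - 2 * (x + 1)) / 5) := by
  constructor <;> intros <;> omega

theorem isCosetParam_threeOne_three :
    IsCosetParam (fun x y => (3 * x + y) % 5) 3 (fun u v => u - 2 * v + 1) (fun u v => 2 * u + v)
      (fun x y => ((x - 1) + 2 * y) / 5) (fun x y => (y - 2 * (x - 1)) / 5) := by
  constructor <;> intros <;> omega

theorem isCosetParam_threeOne_four :
    IsCosetParam (fun x y => (3 * x + y) % 5) 4 (fun u v => u - 2 * v) (fun u v => 2 * u + v - 1)
      (fun x y => (x + 2 * (y + 1)) / 5) (fun x y => ((y + 1) - 2 * x) / 5) := by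
  constructor <;> intros <;> omega

theorem thetaSeries_eight_two_mul_six_four :
    thetaSeries 0 8 2 * thetaSeries 1 6 4 =
      thetaSeries 0 30 20 * thetaSeries 1 20 30 -
      PowerSeries.X ^ 6 * (thetaSeries 0 50 0 * thetaSeries 1 30 20) +
      PowerSeries.X ^ 2 * (thetaSeries 0 20 30 * thetaSeries 1 40 10) -
      PowerSeries.X ^ 4 * (thetaSeries 0 10 40 * thetaSeries 1 10 40) := by
  let κ : ℤ → ℤ → ℤ := fun _ y => y
  let P : ℤ → ℤ → ℤ := fun x y => 10 * x ^ 2 + 6 * x + (10 * y ^ 2 + 2 * y)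
  have hL := hasSum_thetaSeries_mul (κ := κ) (P := P) 0 0 0 8 2 1 6 4
    (by intros; simp only [κ]; omega) (by intros; simp only [P]; push_cast; ring)
  have hR0 := isCosetParam_threeOne_zero.hasSum_qMono κ P 0 0 0 30 20 1 20 30
    (by intros; simp only [κ]; omega) (by intros; simp only [P]; push_cast; ring)
  have hR1 := isCosetParam_threeOne_one.hasSum_qMono κ P 1 6 0 50 0 1 30 20
    (by intros; simp only [κ]; omega) (by intros; simp only [P]; push_cast; ring)
  have hR2 := isCosetParam_threeOne_two.hasSum_qMono κ P 0 2 0 20 30 1 40 10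
    (by intros; simp only [κ]; omega) (by intros; simp only [P]; push_cast; ring)
  have hR3 := isCosetParam_threeOne_three.hasSum_qMono κ P 0 8 0 40 10 1 0 50
    (by intros; simp only [κ]; omega) (by intros; simp only [P]; push_cast; ring)
  have hR4 := isCosetParam_threeOne_four.hasSum_qMono κ P 1 4 0 10 40 1 10 40
    (by intros; simp only [κ]; omega) (by intros; simp only [P]; push_cast; ring)
  have hR := hasSum_of_five_residues (ρ := fun x y => (3 * x + y) % 5)
    (F := fun p => qMono (κ p.1 p.2) (P p.1 p.2)) (fun x y => by omega) hR0 hR1 hR2 hR3 hR4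
  -- The coset of residue 3 contributes nothing: its second theta factor has an argument -1 and
  -- vanishes.
  rw [thetaSeries_comm 1 0 50] at hR
  have h := hL.unique hR
  simp only [qMono_zero_left, qMono_one_left, thetaSeries_one_zero_right] at h
  linear_combination h

/-- The mirror lattice, with orthogonal basis (2, 1), (-1, 2), that is, multiplication by 2 + i. -/
theorem isCosetParam_twoOne_zero :
    IsCosetParam (fun x y => (2 * x + y) % 5) 0 (fun u v => 2 * u - v) (fun u v => u + 2 * v)
      (fun x y => (2 * x + y) / 5) (fun x y => (2 * y - x) / 5) := by
  constructor <;> intros <;> omega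

theorem isCosetParam_twoOne_one :
    IsCosetParam (fun x y => (2 * x + y) % 5) 1 (fun u v => 2 * u - v) (fun u v => u + 2 * v + 1)
      (fun x y => (2 * x + (y - 1)) / 5) (fun x y => (2 * (y - 1) - x) / 5) := by
  constructor <;> intros <;> omega

theorem isCosetParam_twoOne_two :
    IsCosetParam (fun x y => (2 * x + y) % 5) 2 (fun u v => 2 * u - v + 1) (fun u v => u + 2 * v)
      (fun x y => (2 * (x - 1) + y) / 5) (fun x y => (2 * y - (x - 1)) / 5) := by
  constructor <;> intros <;> omega

theorem isCosetParam_twoOne_three :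
    IsCosetParam (fun x y => (2 * x + y) % 5) 3 (fun u v => 2 * u - v - 1) (fun u v => u + 2 * v)
      (fun x y => (2 * (x + 1) + y) / 5) (fun x y => (2 * y - (x + 1)) / 5) := by
  constructor <;> intros <;> omega

theorem isCosetParam_twoOne_four :
    IsCosetParam (fun x y => (2 * x + y) % 5) 4 (fun u v => 2 * u - v) (fun u v => u + 2 * v - 1)
      (fun x y => (2 * x + (y + 1)) / 5) (fun x y => (2 * (y + 1) - x) / 5) := by
  constructor <;> intros <;> omega

theorem thetaSeries_seven_three_mul_six_four :
    thetaSeries 0 7 3 * thetaSeries 1 6 4 =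
      thetaSeries 1 30 20 * thetaSeries 0 25 25 -
      PowerSeries.X ^ 6 * (thetaSeries 1 40 10 * thetaSeries 0 45 5) +
      PowerSeries.X ^ 3 * (thetaSeries 1 10 40 * thetaSeries 0 35 15) -
      PowerSeries.X ^ 4 * (thetaSeries 1 20 30 * thetaSeries 0 5 45) := by
  let κ : ℤ → ℤ → ℤ := fun _ y => y
  let P : ℤ → ℤ → ℤ := fun x y => 10 * x ^ 2 + 4 * x + (10 * y ^ 2 + 2 * y)
  have hL := hasSum_thetaSeries_mul (κ := κ) (P := P) 0 0 0 7 3 1 6 4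
    (by intros; simp only [κ]; omega) (by intros; simp only [P]; push_cast; ring)
  have hR0 := isCosetParam_twoOne_zero.hasSum_qMono κ P 0 0 1 30 20 0 25 25
    (by intros; simp only [κ]; omega) (by intros; simp only [P]; push_cast; ring)
  have hR1 := isCosetParam_twoOne_one.hasSum_qMono κ P 1 6 1 40 10 0 45 5
    (by intros; simp only [κ]; omega) (by intros; simp only [P]; push_cast; ring)
  have hR2 := isCosetParam_twoOne_two.hasSum_qMono κ P 0 7 1 50 0 0 15 35
    (by intros; simp only [κ]; omega) (by intros; simp only [P]; push_cast; ring)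
  have hR3 := isCosetParam_twoOne_three.hasSum_qMono κ P 0 3 1 10 40 0 35 15
    (by intros; simp only [κ]; omega) (by intros; simp only [P]; push_cast; ring)
  have hR4 := isCosetParam_twoOne_four.hasSum_qMono κ P 1 4 1 20 30 0 5 45
    (by intros; simp only [κ]; omega) (by intros; simp only [P]; push_cast; ring)
  have hR := hasSum_of_five_residues (ρ := fun x y => (2 * x + y) % 5)
    (F := fun p => qMono (κ p.1 p.2) (P p.1 p.2)) (fun x y => by omega) hR0 hR1 hR2 hR3 hR4
  have h := hL.unique hR
  simp only [qMono_zero_left, qMono_one_left, thetaSeries_one_zero_right] at h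
  linear_combination h

/-! ### Evaluating the brackets by splitting modulo 3 -/

/-- With y = 3u, completing the square gives 3x² - 4xy + 3y² = 3(x - 2u)² + 15u². This is why
residues modulo 3 diagonalize the form; family B does the same for +4xy with x = 3u. -/
theorem isCosetParam_thirdA_zero :
    IsCosetParam (fun _ y => y % 3) 0 (fun u v => v + 2 * u) (fun u _ => 3 * u)
      (fun _ y => y / 3) (fun x y => x - 2 * (y / 3)) := by
  constructor <;> intros <;> omega

theorem isCosetParam_thirdA_one :
    IsCosetParam (fun _ y => y % 3) 1 (fun u v => v + 2 * u + 1) (fun u _ => 3 * u + 1)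
      (fun _ y => y / 3) (fun x y => x - 2 * (y / 3) - 1) := by
  constructor <;> intros <;> omega

theorem isCosetParam_thirdA_one_shift :
    IsCosetParam (fun _ y => y % 3) 1 (fun u v => v + 2 * u) (fun u _ => 3 * u + 1)
      (fun _ y => y / 3) (fun x y => x - 2 * (y / 3)) := by
  constructor <;> intros <;> omega

theorem isCosetParam_thirdA_two :
    IsCosetParam (fun _ y => y % 3) 2 (fun u v => v - 2 * u - 1) (fun u _ => -3 * u - 1)
      (fun _ y => -(y / 3) - 1) (fun x y => x - 2 * (y / 3) - 1) := by
  constructor <;> intros <;> omega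

theorem isCosetParam_thirdB_zero :
    IsCosetParam (fun x _ => x % 3) 0 (fun u _ => 3 * u) (fun u v => -v - 2 * u)
      (fun x _ => x / 3) (fun x y => -y - 2 * (x / 3)) := by
  constructor <;> intros <;> omega

theorem isCosetParam_thirdB_one :
    IsCosetParam (fun x _ => x % 3) 1 (fun u _ => 3 * u + 1) (fun u v => -1 - 2 * u - v)
      (fun x _ => x / 3) (fun x y => -1 - 2 * (x / 3) - y) := by
  constructor <;> intros <;> omega

theorem isCosetParam_thirdB_two :
    IsCosetParam (fun x _ => x % 3) 2 (fun u _ => 3 * u - 1) (fun u v => 1 - 2 * u - v)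
      (fun x _ => x / 3 + 1) (fun x y => -1 - 2 * (x / 3) - y) := by
  constructor <;> intros <;> omega

/-- The two products on the left are the even and odd halves of a single sum with sign (-1)^(x+y).
Split by y modulo 3 instead, one third vanishes and the other two share the factor f(-q, -q²). -/
theorem thetaSeries_bracket_zero :
    thetaSeries 0 1 1 * thetaSeries 0 6 4 -
        PowerSeries.X * (thetaSeries 0 2 0 * thetaSeries 0 9 1) =
      thetaSeries 1 1 2 * (thetaSeries 1 7 8 + PowerSeries.X * thetaSeries 1 13 2) := by
  let κ : ℤ → ℤ → ℤ := fun x y => x + y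
  let P : ℤ → ℤ → ℤ := fun x y => 3 * x ^ 2 - 4 * x * y + 3 * y ^ 2 + x - y
  have hL0 := isCosetParam_even.hasSum_qMono κ P 0 0 0 1 1 0 6 4
    (by intros; simp only [κ]; omega) (by intros; simp only [P]; push_cast; ring)
  have hL1 := isCosetParam_odd_rev.hasSum_qMono κ P 1 1 0 2 0 0 9 1
    (by intros; simp only [κ]; omega) (by intros; simp only [P]; push_cast; ring)
  have hL := hasSum_of_two_residues (ρ := fun x y => (x + y) % 2)
    (F := fun p => qMono (κ p.1 p.2) (P p.1 p.2)) (fun x y => by omega) hL0 hL1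
  have hR0 := isCosetParam_thirdA_zero.hasSum_qMono κ P 0 0 1 7 8 1 2 1
    (by intros; simp only [κ]; omega) (by intros; simp only [P]; push_cast; ring)
  have hR1 := isCosetParam_thirdA_one.hasSum_qMono κ P 0 1 1 12 3 1 3 0
    (by intros; simp only [κ]; omega) (by intros; simp only [P]; push_cast; ring)
  have hR2 := isCosetParam_thirdA_two.hasSum_qMono κ P 0 1 1 13 2 1 1 2
    (by intros; simp only [κ]; omega) (by intros; simp only [P]; push_cast; ring)
  have hR := hasSum_of_three_residues (ρ := fun _ y => y % 3)
    (F := fun p => qMono (κ p.1 p.2) (P p.1 p.2)) (fun x y => by omega) hR0 hR1 hR2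
  have h := hL.unique hR
  simp only [qMono_zero_left, qMono_one_left, thetaSeries_one_zero_right, thetaSeries_comm 1 2 1] at h
  linear_combination h

theorem thetaSeries_bracket_four :
    thetaSeries 0 2 0 * thetaSeries 0 7 3 - thetaSeries 0 1 1 * thetaSeries 0 8 2 =
      thetaSeries 1 1 2 * (thetaSeries 1 11 4 - PowerSeries.X * thetaSeries 1 14 1) := by
  let κ : ℤ → ℤ → ℤ := fun x y => x + y
  let P : ℤ → ℤ → ℤ := fun x y => 3 * x ^ 2 - 4 * x * y + 3 * y ^ 2 + 3 * x - 3 * y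
  have hL0 := isCosetParam_even.hasSum_qMono κ P 0 0 0 1 1 0 8 2
    (by intros; simp only [κ]; omega) (by intros; simp only [P]; push_cast; ring)
  have hL1 := isCosetParam_odd_rev.hasSum_qMono κ P 1 0 0 2 0 0 7 3
    (by intros; simp only [κ]; omega) (by intros; simp only [P]; push_cast; ring)
  have hL := hasSum_of_two_residues (ρ := fun x y => (x + y) % 2)
    (F := fun p => qMono (κ p.1 p.2) (P p.1 p.2)) (fun x y => by omega) hL0 hL1
  have hR0 := isCosetParam_thirdA_zero.hasSum_qMono κ P 0 0 1 6 9 1 3 0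
    (by intros; simp only [κ]; omega) (by intros; simp only [P]; push_cast; ring)
  have hR1 := isCosetParam_thirdA_one_shift.hasSum_qMono κ P 1 0 1 11 4 1 1 2
    (by intros; simp only [κ]; omega) (by intros; simp only [P]; push_cast; ring)
  have hR2 := isCosetParam_thirdA_two.hasSum_qMono κ P 0 1 1 14 1 1 2 1
    (by intros; simp only [κ]; omega) (by intros; simp only [P]; push_cast; ring)
  have hR := hasSum_of_three_residues (ρ := fun _ y => y % 3)
    (F := fun p => qMono (κ p.1 p.2) (P p.1 p.2)) (fun x y => by omega) hR0 hR1 hR2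
  have h := hL.unique hR
  simp only [qMono_zero_left, qMono_one_left, thetaSeries_one_zero_right, thetaSeries_comm 1 2 1] at h
  linear_combination -h

/-- Same method; here the two surviving thirds are equal, whence the factor 2. -/
theorem thetaSeries_bracket_one :
    thetaSeries 0 5 5 * thetaSeries 0 2 0 -
        PowerSeries.X * (thetaSeries 0 10 0 * thetaSeries 0 1 1) =
      2 * (thetaSeries 1 5 10 * thetaSeries 1 1 2) := by
  let κ : ℤ → ℤ → ℤ := fun x y => x + y
  let P : ℤ → ℤ → ℤ := fun x y => 3 * x ^ 2 + 4 * x * y + 3 * y ^ 2 + x - y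
  have hL0 := isCosetParam_even.hasSum_qMono κ P 0 0 0 5 5 0 2 0
    (by intros; simp only [κ]; omega) (by intros; simp only [P]; push_cast; ring)
  have hL1 := isCosetParam_odd_right.hasSum_qMono κ P 1 1 0 10 0 0 1 1
    (by intros; simp only [κ]; omega) (by intros; simp only [P]; push_cast; ring)
  have hL := hasSum_of_two_residues (ρ := fun x y => (x + y) % 2)
    (F := fun p => qMono (κ p.1 p.2) (P p.1 p.2)) (fun x y => by omega) hL0 hL1
  have hR0 := isCosetParam_thirdB_zero.hasSum_qMono κ P 0 0 1 10 5 1 2 1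
    (by intros; simp only [κ]; omega) (by intros; simp only [P]; push_cast; ring)
  have hR1 := isCosetParam_thirdB_one.hasSum_qMono κ P 0 2 1 15 0 1 3 0
    (by intros; simp only [κ]; omega) (by intros; simp only [P]; push_cast; ring)
  have hR2 := isCosetParam_thirdB_two.hasSum_qMono κ P 0 0 1 5 10 1 1 2
    (by intros; simp only [κ]; omega) (by intros; simp only [P]; push_cast; ring)
  have hR := hasSum_of_three_residues (ρ := fun x _ => x % 3)
    (F := fun p => qMono (κ p.1 p.2) (P p.1 p.2)) (fun x y => by omega) hR0 hR1 hR2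
  have h := hL.unique hR
  simp only [qMono_zero_left, qMono_one_left, thetaSeries_one_zero_right, thetaSeries_comm 1 2 1, thetaSeries_comm 1 10 5] at h
  linear_combination h

/-! ### Two cases of the quintuple product identity -/

/-- The substitutions from here on need not diagonalize anything: they are chosen so that the
exponents of matching halves agree as polynomials. -/
theorem isCosetParam_skew_even :
    IsCosetParam (fun x y => (x + y) % 2) 0 (fun u v => 2 * u - v) (fun _ v => v)
      (fun x y => (x + y) / 2) (fun _ y => y) := by
  constructor <;> intros <;> omega

theorem isCosetParam_skew_odd :
    IsCosetParam (fun x y => (x + y) % 2) 1 (fun u v => 2 * u + 1 - v) (fun _ v => v)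
      (fun x y => (x + y) / 2) (fun _ y => y) := by
  constructor <;> intros <;> omega

theorem isCosetParam_quintA_even :
    IsCosetParam (fun x y => (x + y) % 2) 0 (fun u v => -u - 1 - v) (fun u v => v - u - 1)
      (fun x y => -((x + y) / 2) - 1) (fun x y => y - (x + y) / 2) := by
  constructor <;> intros <;> omega

theorem isCosetParam_quintA_target_even :
    IsCosetParam (fun x y => (x + y) % 2) 0 (fun u v => u - 2 * v) (fun u _ => u)
      (fun _ y => y) (fun x y => (y - x) / 2) := by
  constructor <;> intros <;> omega

theorem isCosetParam_quintA_target_odd :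
    IsCosetParam (fun x y => (x + y) % 2) 1 (fun u v => u - 2 * v) (fun u _ => -u - 1)
      (fun _ y => -y - 1) (fun x y => (-1 - x - y) / 2) := by
  constructor <;> intros <;> omega

theorem isCosetParam_quintB_odd :
    IsCosetParam (fun x y => (x + y) % 2) 1 (fun u v => 2 * v - 1 - u) (fun u _ => u)
      (fun _ y => y) (fun x y => (x + y + 1) / 2) := by
  constructor <;> intros <;> omega

theorem isCosetParam_quintB_target_even :
    IsCosetParam (fun x y => (x + y) % 2) 0 (fun u v => -u - v) (fun u v => u - v)
      (fun x y => (y - x) / 2) (fun x y => -((x + y) / 2)) := by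
  constructor <;> intros <;> omega

theorem isCosetParam_quintB_target_odd :
    IsCosetParam (fun x y => (x + y) % 2) 1 (fun u v => -u - v - 1) (fun u v => v - u)
      (fun x y => (-x - y) / 2) (fun x y => (y - x) / 2) := by
  constructor <;> intros <;> omega

/-- Each of the three double series is split by the parity of x + y. One half of each left-hand
product matches a half of the right-hand side (`h₁`, `h₂`), and the two remaining halves cancel
(`h₃`). -/
theorem thetaSeries_quintuple_one_four :
    thetaSeries 1 4 1 * (thetaSeries 1 8 7 + PowerSeries.X * thetaSeries 1 13 2) =
      thetaSeries 1 3 2 * thetaSeries 1 10 5 := by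
  let κA : ℤ → ℤ → ℤ := fun x y => x + y
  let PA : ℤ → ℤ → ℤ := fun x y => 5 * x ^ 2 + 3 * x + (15 * y ^ 2 + y)
  have hA := hasSum_thetaSeries_mul (κ := κA) (P := PA) 0 0 1 4 1 1 8 7
    (by intros; simp only [κA]; omega) (by intros; simp only [PA]; push_cast; ring)
  have hA' := hA.unique (hasSum_of_two_residues (ρ := fun x y => (x + y) % 2)
    (F := fun p => qMono (κA p.1 p.2) (PA p.1 p.2)) (fun x y => by omega)
    (isCosetParam_skew_even.hasSum_tsum hA.summable)
    (isCosetParam_skew_odd.hasSum_tsum hA.summable))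
  let κB : ℤ → ℤ → ℤ := fun x y => x + y
  let PB : ℤ → ℤ → ℤ := fun x y => 2 + (5 * x ^ 2 + 3 * x) + (15 * y ^ 2 + 11 * y)
  have hB := hasSum_thetaSeries_mul (κ := κB) (P := PB) 0 1 1 4 1 1 13 2
    (by intros; simp only [κB]; omega) (by intros; simp only [PB]; push_cast; ring)
  have hB' := hB.unique (hasSum_of_two_residues (ρ := fun x y => (x + y) % 2)
    (F := fun p => qMono (κB p.1 p.2) (PB p.1 p.2)) (fun x y => by omega)
    (isCosetParam_quintA_even.hasSum_tsum hB.summable)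
    (isCosetParam_skew_odd.hasSum_tsum hB.summable))
  let κR : ℤ → ℤ → ℤ := fun x y => x + y
  let PR : ℤ → ℤ → ℤ := fun x y => 5 * x ^ 2 + x + (15 * y ^ 2 + 5 * y)
  have hR := hasSum_thetaSeries_mul (κ := κR) (P := PR) 0 0 1 3 2 1 10 5
    (by intros; simp only [κR]; omega) (by intros; simp only [PR]; push_cast; ring)
  have hR' := hR.unique (hasSum_of_two_residues (ρ := fun x y => (x + y) % 2)
    (F := fun p => qMono (κR p.1 p.2) (PR p.1 p.2)) (fun x y => by omega)
    (isCosetParam_quintA_target_even.hasSum_tsum hR.summable)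
    (isCosetParam_quintA_target_odd.hasSum_tsum hR.summable))
  have h₁ : (∑' p : ℤ × ℤ, qMono (κA (2 * p.1 - p.2) (p.2)) (PA (2 * p.1 - p.2) (p.2))) =
      (∑' p : ℤ × ℤ, qMono (κR (p.1 - 2 * p.2) (p.1)) (PR (p.1 - 2 * p.2) (p.1))) := by
    refine tsum_congr fun p => qMono_congr ?_ ?_
    · simp only [κA, κR]; omega
    · simp only [PA, PR]; ring
  have h₂ : (∑' p : ℤ × ℤ, qMono (κB (2 * p.1 + 1 - p.2) (p.2)) (PB (2 * p.1 + 1 - p.2) (p.2))) =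
      (∑' p : ℤ × ℤ, qMono (κR (p.1 - 2 * p.2) (-p.1 - 1)) (PR (p.1 - 2 * p.2) (-p.1 - 1))) := by
    refine tsum_congr fun p => qMono_congr ?_ ?_
    · simp only [κB, κR]; omega
    · simp only [PB, PR]; ring
  have h₃ : (∑' p : ℤ × ℤ, qMono (κA (2 * p.1 + 1 - p.2) (p.2)) (PA (2 * p.1 + 1 - p.2) (p.2))) =
      -(∑' p : ℤ × ℤ, qMono (κB (-p.1 - 1 - p.2) (p.2 - p.1 - 1)) (PB (-p.1 - 1 - p.2) (p.2 - p.1 - 1))) := by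
    rw [← tsum_neg]
    refine tsum_congr fun p => ?_
    rw [← qMono_succ]
    refine qMono_congr ?_ ?_
    · simp only [κA, κB]; omega
    · simp only [PA, PB]; ring
  simp only [h₁, h₂, h₃, qMono_zero_left] at hA' hB' hR'
  linear_combination hA' + hB' - hR'

theorem thetaSeries_quintuple_two_three :
    thetaSeries 1 3 2 * (thetaSeries 1 4 11 - PowerSeries.X * thetaSeries 1 14 1) =
      thetaSeries 1 4 1 * thetaSeries 1 10 5 := by
  let κA : ℤ → ℤ → ℤ := fun x y => x + y
  let PA : ℤ → ℤ → ℤ := fun x y => 5 * x ^ 2 + x + (15 * y ^ 2 - 7 * y)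
  have hA := hasSum_thetaSeries_mul (κ := κA) (P := PA) 0 0 1 3 2 1 4 11
    (by intros; simp only [κA]; omega) (by intros; simp only [PA]; push_cast; ring)
  have hA' := hA.unique (hasSum_of_two_residues (ρ := fun x y => (x + y) % 2)
    (F := fun p => qMono (κA p.1 p.2) (PA p.1 p.2)) (fun x y => by omega)
    (isCosetParam_skew_even.hasSum_tsum hA.summable)
    (isCosetParam_skew_odd.hasSum_tsum hA.summable))
  let κB : ℤ → ℤ → ℤ := fun x y => x + y + 1
  let PB : ℤ → ℤ → ℤ := fun x y => 2 + (5 * x ^ 2 + x) + (15 * y ^ 2 + 13 * y)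
  have hB := hasSum_thetaSeries_mul (κ := κB) (P := PB) 1 1 1 3 2 1 14 1
    (by intros; simp only [κB]; omega) (by intros; simp only [PB]; push_cast; ring)
  have hB' := hB.unique (hasSum_of_two_residues (ρ := fun x y => (x + y) % 2)
    (F := fun p => qMono (κB p.1 p.2) (PB p.1 p.2)) (fun x y => by omega)
    (isCosetParam_skew_even.hasSum_tsum hB.summable)
    (isCosetParam_quintB_odd.hasSum_tsum hB.summable))
  let κR : ℤ → ℤ → ℤ := fun x y => x + y
  let PR : ℤ → ℤ → ℤ := fun x y => 5 * x ^ 2 + 3 * x + (15 * y ^ 2 + 5 * y)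
  have hR := hasSum_thetaSeries_mul (κ := κR) (P := PR) 0 0 1 4 1 1 10 5
    (by intros; simp only [κR]; omega) (by intros; simp only [PR]; push_cast; ring)
  have hR' := hR.unique (hasSum_of_two_residues (ρ := fun x y => (x + y) % 2)
    (F := fun p => qMono (κR p.1 p.2) (PR p.1 p.2)) (fun x y => by omega)
    (isCosetParam_quintB_target_even.hasSum_tsum hR.summable)
    (isCosetParam_quintB_target_odd.hasSum_tsum hR.summable))
  have h₁ : (∑' p : ℤ × ℤ, qMono (κA (2 * p.1 - p.2) (p.2)) (PA (2 * p.1 - p.2) (p.2))) =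
      (∑' p : ℤ × ℤ, qMono (κR (-p.1 - p.2) (p.1 - p.2)) (PR (-p.1 - p.2) (p.1 - p.2))) := by
    refine tsum_congr fun p => qMono_congr ?_ ?_
    · simp only [κA, κR]; omega
    · simp only [PA, PR]; ring
  have h₂ : (∑' p : ℤ × ℤ, qMono (κB (2 * p.1 - p.2) (p.2)) (PB (2 * p.1 - p.2) (p.2))) =
      (∑' p : ℤ × ℤ, qMono (κR (-p.1 - p.2 - 1) (p.2 - p.1)) (PR (-p.1 - p.2 - 1) (p.2 - p.1))) := by
    refine tsum_congr fun p => qMono_congr ?_ ?_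
    · simp only [κB, κR]; omega
    · simp only [PB, PR]; ring
  have h₃ : (∑' p : ℤ × ℤ, qMono (κA (2 * p.1 + 1 - p.2) (p.2)) (PA (2 * p.1 + 1 - p.2) (p.2))) =
      -(∑' p : ℤ × ℤ, qMono (κB (2 * p.2 - 1 - p.1) (p.1)) (PB (2 * p.2 - 1 - p.1) (p.1))) := by
    rw [← tsum_neg]
    refine tsum_congr fun p => ?_
    rw [← qMono_succ]
    refine qMono_congr ?_ ?_
    · simp only [κA, κB]; omega
    · simp only [PA, PB]; ring
  simp only [h₁, h₂, h₃, qMono_zero_left, qMono_one_left] at hA' hB' hR'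
  linear_combination hA' + hB' - hR'

/-! ### The Jacobi triple product identity -/

/-- The Gaussian binomial coefficient `[n, k]` in base `Q`. -/
def gaussBinom {R : Type*} [CommRing R] (Q : R) : ℕ → ℕ → R
  | _, 0 => 1
  | 0, _ + 1 => 0
  | n + 1, k + 1 => gaussBinom Q n k + Q ^ (k + 1) * gaussBinom Q n (k + 1)

section GaussBinom

variable {R : Type*} [CommRing R] (Q : R)

@[simp] theorem gaussBinom_zero_right (n : ℕ) : gaussBinom Q n 0 = 1 := by
  cases n <;> rfl

theorem gaussBinom_succ_succ (n k : ℕ) :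
    gaussBinom Q (n + 1) (k + 1) = gaussBinom Q n k + Q ^ (k + 1) * gaussBinom Q n (k + 1) := rfl

theorem gaussBinom_eq_zero {n k : ℕ} (h : n < k) : gaussBinom Q n k = 0 := by
  induction n generalizing k with
  | zero => obtain ⟨k, rfl⟩ := Nat.exists_eq_succ_of_ne_zero h.ne'; rfl
  | succ n ih =>
    obtain ⟨k, rfl⟩ := Nat.exists_eq_succ_of_ne_zero (Nat.ne_zero_of_lt h)
    rw [Nat.succ_eq_add_one, gaussBinom_succ_succ, ih (by omega), ih (by omega)]
    ring

theorem gaussBinom_self (n : ℕ) : gaussBinom Q n n = 1 := by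
  induction n with
  | zero => rfl
  | succ n ih => rw [gaussBinom_succ_succ, ih, gaussBinom_eq_zero Q n.lt_succ_self]; ring

/-- The mirror Pascal rule. The upper index is written k + d to avoid subtraction in the exponent.
-/
theorem gaussBinom_succ_succ' (k d : ℕ) :
    gaussBinom Q (k + d + 1) (k + 1) =
      Q ^ d * gaussBinom Q (k + d) k + gaussBinom Q (k + d) (k + 1) := by
  obtain ⟨n, hn⟩ : ∃ n, n = k + d := ⟨_, rfl⟩
  induction n generalizing k d with
  | zero =>
    obtain ⟨rfl, rfl⟩ : k = 0 ∧ d = 0 := by omega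
    simp [gaussBinom]
  | succ n ih =>
    rcases k with - | k
    · obtain rfl : d = n + 1 := by omega
      have h := ih 0 n (by omega)
      have h' := gaussBinom_succ_succ Q n 0
      have h'' := gaussBinom_succ_succ Q (n + 1) 0
      simp only [zero_add, gaussBinom_zero_right] at h h' h'' ⊢
      linear_combination h'' + Q * h - h'
    · rcases d with - | d
      · rw [add_zero, gaussBinom_self, gaussBinom_self, gaussBinom_eq_zero Q (k + 1).lt_succ_self]
        ring
      · obtain ⟨m, hm⟩ : ∃ m, m = k + (d + 1) := ⟨_, rfl⟩
        have h1 := ih k (d + 1) (by omega)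
        have h2 := ih (k + 1) d (by omega)
        rw [← hm] at h1
        rw [show k + 1 + d = m by omega] at h2
        rw [show k + 1 + (d + 1) = m + 1 by omega]
        linear_combination gaussBinom_succ_succ Q (m + 1) (k + 1) + h1 + Q ^ (k + 2) * h2 -
          Q ^ (d + 1) * gaussBinom_succ_succ Q m k - gaussBinom_succ_succ Q m (k + 1)

/-- The factorial formula without denominators. The two Pascal terms carry the weights 1 - Q^(j+1)
and Q^(j+1)(1 - Q^(k+1)), whose sum 1 - Q^(j+k+2) is the new last factor. -/
theorem gaussBinom_mul_prod_mul_prod (j k : ℕ) :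
    gaussBinom Q (j + k) j *
      ((∏ i ∈ Finset.range j, (1 - Q * Q ^ i)) * ∏ i ∈ Finset.range k, (1 - Q * Q ^ i)) =
      ∏ i ∈ Finset.range (j + k), (1 - Q * Q ^ i) := by
  obtain ⟨n, hn⟩ : ∃ n, n = j + k := ⟨_, rfl⟩
  induction n generalizing j k with
  | zero =>
    obtain ⟨rfl, rfl⟩ : j = 0 ∧ k = 0 := by omega
    simp
  | succ n ih =>
    cases j with
    | zero => simp
    | succ j =>
      cases k with
      | zero => simp [gaussBinom_self]
      | succ k =>
        have h1 := ih j (k + 1) (by omega)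
        have h2 := ih (j + 1) k (by omega)
        rw [show j + 1 + (k + 1) = j + (k + 1) + 1 by ring, gaussBinom_succ_succ,
          Finset.prod_range_succ _ (j + (k + 1))]
        rw [show j + 1 + k = j + (k + 1) by ring] at h2
        rw [Finset.prod_range_succ _ k] at h1 ⊢
        rw [Finset.prod_range_succ _ j] at h2 ⊢
        have e : Q ^ (j + (k + 1)) = Q ^ j * (Q * Q ^ k) := by ring
        rw [e]
        linear_combination (1 - Q * Q ^ j) * h1 + (Q ^ (j + 1)) * (1 - Q * Q ^ k) * h2

end GaussBinom

theorem qMono_mul_X_pow (k : ℤ) {P : ℤ} (hP : 0 ≤ P) (e : ℕ) :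
    qMono k P * PowerSeries.X ^ e = qMono k (2 * e + P) := by
  rw [← qMono_zero_left, mul_comm, qMono_mul_qMono _ _ (by positivity) hP (by omega), zero_add]

theorem X_pow_natAbs_dvd_thetaTerm {a b : ℕ} (ha : 0 < a) (hb : 0 < b) (s n : ℤ) :
    (PowerSeries.X : ℤ⟦X⟧) ^ n.natAbs ∣ qMono (s * n) (thetaExp a b n) := by
  have h1 := mul_add_one_nonneg n
  have h2 := mul_sub_one_nonneg n
  have h3 : 2 * (n.natAbs : ℤ) ≤ thetaExp a b n := by
    have h4 : (n.natAbs : ℤ) ≤ n * n := by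
      rw [Int.natCast_natAbs]
      rcases abs_cases n with ⟨h, _⟩ | ⟨h, _⟩ <;> rw [h] <;> nlinarith
    rw [thetaExp_eq]
    nlinarith [mul_le_mul_of_nonneg_right (show (1 : ℤ) ≤ a by omega) h1,
      mul_le_mul_of_nonneg_right (show (1 : ℤ) ≤ b by omega) h2]
  rw [PowerSeries.X_pow_dvd_iff]
  intro d hd
  rw [qMono, PowerSeries.coeff_monomial, if_neg (by omega)]

section FiniteTripleProduct

variable (s : ℤ) (a b : ℕ)

theorem qMono_mul_thetaTerm_pred (n : ℕ) (j : ℤ) (d : ℕ) (hd : (d : ℤ) = n - j) :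
    qMono s (2 * a) * (PowerSeries.X ^ (a + b)) ^ n * qMono (s * j) (thetaExp a b j) =
      (PowerSeries.X ^ (a + b)) ^ d * qMono (s * (j + 1)) (thetaExp a b (j + 1)) := by
  rw [← pow_mul, ← pow_mul, qMono_mul_X_pow _ (by positivity),
    qMono_mul_qMono _ _ (by positivity) (thetaExp_nonneg _ _ _) (by omega),
    mul_comm (PowerSeries.X ^ _), qMono_mul_X_pow _ (thetaExp_nonneg _ _ _)]
  refine qMono_congr (by ring_nf; simp) ?_
  simp only [thetaExp, Nat.cast_mul, Nat.cast_add, hd]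
  ring

theorem qMono_mul_thetaTerm_succ (m : ℕ) (j : ℤ) (d : ℕ) (hd : (d : ℤ) = m + j) :
    qMono s (2 * b) * (PowerSeries.X ^ (a + b)) ^ m * qMono (s * j) (thetaExp a b j) =
      (PowerSeries.X ^ (a + b)) ^ d * qMono (s * (j - 1)) (thetaExp a b (j - 1)) := by
  rw [← pow_mul, ← pow_mul, qMono_mul_X_pow _ (by positivity),
    qMono_mul_qMono _ _ (by positivity) (thetaExp_nonneg _ _ _) (by omega),
    mul_comm (PowerSeries.X ^ _), qMono_mul_X_pow _ (thetaExp_nonneg _ _ _)]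
  refine qMono_congr (by rw [← Int.even_iff]; exact ⟨s, by ring⟩) ?_
  simp only [thetaExp, Nat.cast_mul, Nat.cast_add, hd]
  ring

/-- The sum side of the finite Jacobi triple product identity. -/
noncomputable def finiteTheta (n m : ℕ) : ℤ⟦X⟧ :=
  ∑ k ∈ Finset.range (n + m + 1), gaussBinom (PowerSeries.X ^ (a + b)) (n + m) k *
    qMono (s * (k - m)) (thetaExp a b (k - m))

/-- The extra factor shifts the theta terms by one index, and the mirror Pascal rule recombines the
coefficients; `finiteTheta_succ_right` uses the defining rule in the same way. -/
theorem finiteTheta_succ_left (n m : ℕ) :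
    finiteTheta s a b (n + 1) m =
      (1 + qMono s (2 * a) * (PowerSeries.X ^ (a + b)) ^ n) * finiteTheta s a b n m := by
  have h1 : finiteTheta s a b n m = qMono (s * (0 - m)) (thetaExp a b (0 - m)) +
      ∑ k ∈ Finset.range (n + m + 1), gaussBinom (PowerSeries.X ^ (a + b)) (n + m) (k + 1) *
        qMono (s * (k - m + 1)) (thetaExp a b (k - m + 1)) := by
    rw [Finset.sum_range_succ, gaussBinom_eq_zero _ (n + m).lt_succ_self, zero_mul, add_zero,
      finiteTheta, Finset.sum_range_succ', add_comm]
    congr 1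
    · simp
    · refine Finset.sum_congr rfl fun k _ => ?_
      push_cast
      ring_nf
  have h2 : ∑ k ∈ Finset.range (n + m + 1),
      gaussBinom (PowerSeries.X ^ (a + b)) (n + 1 + m) (k + 1) *
        qMono (s * ((k + 1 : ℕ) - m)) (thetaExp a b ((k + 1 : ℕ) - m)) =
      (∑ k ∈ Finset.range (n + m + 1), gaussBinom (PowerSeries.X ^ (a + b)) (n + m) (k + 1) *
        qMono (s * (k - m + 1)) (thetaExp a b (k - m + 1))) +
      qMono s (2 * a) * (PowerSeries.X ^ (a + b)) ^ n * finiteTheta s a b n m := by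
    rw [finiteTheta, Finset.mul_sum, ← Finset.sum_add_distrib]
    refine Finset.sum_congr rfl fun k hk => ?_
    obtain ⟨d, hd⟩ := Nat.exists_eq_add_of_le (Nat.lt_succ_iff.mp (Finset.mem_range.mp hk))
    rw [mul_left_comm, qMono_mul_thetaTerm_pred s a b n (k - m) d (by omega),
      show n + 1 + m = k + d + 1 by omega, gaussBinom_succ_succ', hd,
      show (((k + 1 : ℕ) : ℤ) - m) = k - m + 1 by push_cast; ring]
    ring
  rw [add_mul, one_mul, finiteTheta, show n + 1 + m + 1 = (n + m + 1) + 1 by ring,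
    Finset.sum_range_succ', h2, gaussBinom_zero_right, one_mul, Nat.cast_zero]
  linear_combination -h1

theorem finiteTheta_succ_right (n m : ℕ) :
    finiteTheta s a b n (m + 1) =
      (1 + qMono s (2 * b) * (PowerSeries.X ^ (a + b)) ^ m) * finiteTheta s a b n m := by
  have hrec : ∀ k : ℕ, qMono s (2 * b) * (PowerSeries.X ^ (a + b)) ^ m *
      qMono (s * (k - m)) (thetaExp a b (k - m)) =
      (PowerSeries.X ^ (a + b)) ^ k * qMono (s * (k - m - 1)) (thetaExp a b (k - m - 1)) :=
    fun k => qMono_mul_thetaTerm_succ s a b m _ k (by ring)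
  have h1 : qMono s (2 * b) * (PowerSeries.X ^ (a + b)) ^ m * finiteTheta s a b n m =
      qMono (s * (0 - m - 1)) (thetaExp a b (0 - m - 1)) +
      ∑ k ∈ Finset.range (n + m + 1), (PowerSeries.X ^ (a + b)) ^ (k + 1) *
        gaussBinom (PowerSeries.X ^ (a + b)) (n + m) (k + 1) *
        qMono (s * (k - m)) (thetaExp a b (k - m)) := by
    rw [Finset.sum_range_succ, gaussBinom_eq_zero _ (n + m).lt_succ_self, mul_zero, zero_mul,
      add_zero, finiteTheta, Finset.mul_sum, Finset.sum_range_succ', add_comm]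
    congr 1
    · rw [mul_left_comm, hrec]
      simp
    · refine Finset.sum_congr rfl fun k _ => ?_
      rw [mul_left_comm, hrec, show (((k + 1 : ℕ) : ℤ) - m - 1) = k - m by push_cast; ring]
      ring
  have h2 : ∑ k ∈ Finset.range (n + m + 1),
      gaussBinom (PowerSeries.X ^ (a + b)) (n + (m + 1)) (k + 1) *
        qMono (s * ((k + 1 : ℕ) - (m + 1 : ℕ))) (thetaExp a b ((k + 1 : ℕ) - (m + 1 : ℕ))) =
      finiteTheta s a b n m +
      ∑ k ∈ Finset.range (n + m + 1), (PowerSeries.X ^ (a + b)) ^ (k + 1) *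
        gaussBinom (PowerSeries.X ^ (a + b)) (n + m) (k + 1) *
        qMono (s * (k - m)) (thetaExp a b (k - m)) := by
    rw [finiteTheta, ← Finset.sum_add_distrib]
    refine Finset.sum_congr rfl fun k _ => ?_
    rw [show n + (m + 1) = n + m + 1 by ring, gaussBinom_succ_succ,
      show (((k + 1 : ℕ) : ℤ) - ((m + 1 : ℕ) : ℤ)) = k - m by push_cast; ring]
    ring
  have h0 : ((0 : ℕ) : ℤ) - ((m + 1 : ℕ) : ℤ) = 0 - m - 1 := by push_cast; ring
  rw [add_mul, one_mul, finiteTheta, show n + (m + 1) + 1 = (n + m + 1) + 1 by ring,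
    Finset.sum_range_succ', h2, gaussBinom_zero_right, one_mul, h0]
  linear_combination -h1

theorem finiteTheta_eq_prod (n m : ℕ) :
    finiteTheta s a b n m =
      (∏ k ∈ Finset.range n, (1 + qMono s (2 * a) * (PowerSeries.X ^ (a + b)) ^ k)) *
        ∏ k ∈ Finset.range m, (1 + qMono s (2 * b) * (PowerSeries.X ^ (a + b)) ^ k) := by
  induction m with
  | zero =>
    induction n with
    | zero => simp [finiteTheta, thetaExp, qMono]
    | succ n ih => rw [finiteTheta_succ_left, ih, Finset.prod_range_succ]; ring
  | succ m ih => rw [finiteTheta_succ_right, ih, Finset.prod_range_succ _ m]; ring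

end FiniteTripleProduct

/-! ### Infinite products -/

theorem constantCoeff_X_pow_eq_zero {m : ℕ} (hm : 0 < m) :
    PowerSeries.constantCoeff ((PowerSeries.X : ℤ⟦X⟧) ^ m) = 0 := by
  rw [map_pow, PowerSeries.constantCoeff_X, zero_pow hm.ne']

theorem qPochhammerInf_eq_prod_mul (a : ℤ⟦X⟧) {q : ℤ⟦X⟧} (hq : PowerSeries.constantCoeff q = 0)
    (n : ℕ) : qPochhammerInf a q =
      (∏ k ∈ Finset.range n, (1 - a * q ^ k)) * qPochhammerInf (a * q ^ n) q := by
  have h := multipliable_qPochhammerInf (a * q ^ n) q hq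
  have h' : Multipliable fun k => 1 - a * q ^ (k + n) := by
    refine h.congr fun k => ?_
    rw [pow_add]; ring
  rw [qPochhammerInf, qPochhammerInf,
    ← Multipliable.prod_mul_tprod_nat_mul' (f := fun k => 1 - a * q ^ k) (k := n) h']
  congr 1
  exact tprod_congr fun k => by rw [pow_add]; ring

/-- The congruence holds for every partial product and passes to the limit because coefficients are
continuous. -/
theorem X_pow_dvd_qPochhammerInf_sub_one {a q : ℤ⟦X⟧} (hq : PowerSeries.constantCoeff q = 0)
    {n : ℕ} (h : PowerSeries.X ^ n ∣ a) : PowerSeries.X ^ n ∣ qPochhammerInf a q - 1 := by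
  have hfin : ∀ N, PowerSeries.X ^ n ∣ (∏ k ∈ Finset.range N, (1 - a * q ^ k)) - 1 := by
    intro N
    induction N with
    | zero => simp
    | succ N ih =>
      rw [Finset.prod_range_succ]
      have e : ∀ x : ℤ⟦X⟧, x * (1 - a * q ^ N) - 1 = (x - 1) - a * (q ^ N * x) := fun x => by ring
      rw [e]
      exact dvd_sub ih (h.mul_right _)
  rw [PowerSeries.X_pow_dvd_iff]
  intro d hd
  have h1 := (multipliable_qPochhammerInf a q hq).hasProd.tendsto_prod_nat
  have h2 := ((PowerSeries.WithPiTopology.continuous_coeff ℤ d).tendsto _).comp h1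
  have h3 : ∀ N, PowerSeries.coeff d (∏ k ∈ Finset.range N, (1 - a * q ^ k)) =
      PowerSeries.coeff d (1 : ℤ⟦X⟧) := fun N => by
    have := (PowerSeries.X_pow_dvd_iff.mp (hfin N)) d hd
    rwa [map_sub, sub_eq_zero] at this
  have h4 := tendsto_nhds_unique h2 (tendsto_const_nhds.congr fun N => (h3 N).symm)
  rw [map_sub, sub_eq_zero]
  exact h4

theorem X_pow_dvd_qPochhammerInf_sub_prod {m : ℕ} (hm : 0 < m) (a : ℤ⟦X⟧) (n : ℕ) :
    PowerSeries.X ^ n ∣ qPochhammerInf a (PowerSeries.X ^ m) -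
      ∏ k ∈ Finset.range n, (1 - a * (PowerSeries.X ^ m) ^ k) := by
  have hq := constantCoeff_X_pow_eq_zero hm
  rw [qPochhammerInf_eq_prod_mul a hq n, ← mul_sub_one]
  refine (X_pow_dvd_qPochhammerInf_sub_one hq ?_).mul_left _
  rw [← pow_mul]
  exact (pow_dvd_pow _ (Nat.le_mul_of_pos_left n hm)).mul_left _

theorem constantCoeff_qPochhammerInf {a q : ℤ⟦X⟧} (hq : PowerSeries.constantCoeff q = 0)
    (ha : PowerSeries.constantCoeff a = 0) : PowerSeries.constantCoeff (qPochhammerInf a q) = 1 := by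
  have h := X_pow_dvd_qPochhammerInf_sub_one hq (a := a) (n := 1)
    (by rw [pow_one]; exact PowerSeries.X_dvd_iff.mpr ha)
  rw [pow_one, PowerSeries.X_dvd_iff, map_sub, map_one, sub_eq_zero] at h
  exact h

theorem dvd_of_dvd_mul_of_constantCoeff {f g : ℤ⟦X⟧} {n : ℕ}
    (hf : PowerSeries.constantCoeff f = 1) (h : PowerSeries.X ^ n ∣ f * g) :
    PowerSeries.X ^ n ∣ g := by
  have hu : IsUnit f := PowerSeries.isUnit_iff_constantCoeff.mpr (hf ▸ isUnit_one)
  exact (hu.dvd_mul_left).mp h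

/-- Modulo q^n all three finite products in the factorial formula equal p = (q^M; q^M)_∞, so p²
times the binomial is p, and the unit p cancels. -/
theorem X_pow_dvd_qPochhammerInf_mul_gaussBinom_sub_one {M : ℕ} (hM : 0 < M) (j k n : ℕ)
    (hj : n ≤ j) (hk : n ≤ k) :
    (PowerSeries.X : ℤ⟦X⟧) ^ n ∣
      qPochhammerInf (PowerSeries.X ^ M) (PowerSeries.X ^ M) *
        gaussBinom (PowerSeries.X ^ M) (j + k) j - 1 := by
  have hq := constantCoeff_X_pow_eq_zero hM
  have h := gaussBinom_mul_prod_mul_prod (PowerSeries.X ^ M : ℤ⟦X⟧) j k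
  have hc : ∀ i, n ≤ i → (PowerSeries.X : ℤ⟦X⟧) ^ n ∣
      qPochhammerInf (PowerSeries.X ^ M) (PowerSeries.X ^ M) -
        ∏ l ∈ Finset.range i, (1 - PowerSeries.X ^ M * (PowerSeries.X ^ M) ^ l) := fun i hi =>
    (pow_dvd_pow _ hi).trans (X_pow_dvd_qPochhammerInf_sub_prod hM _ i)
  obtain ⟨u, hu⟩ := hc j hj
  obtain ⟨v, hv⟩ := hc k hk
  obtain ⟨w, hw⟩ := hc (j + k) (hj.trans (Nat.le_add_right j k))
  refine dvd_of_dvd_mul_of_constantCoeff (constantCoeff_qPochhammerInf hq hq) ?_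
  generalize qPochhammerInf (PowerSeries.X ^ M : ℤ⟦X⟧) (PowerSeries.X ^ M) = p at *
  generalize gaussBinom (PowerSeries.X ^ M : ℤ⟦X⟧) (j + k) j = g at *
  generalize ∏ l ∈ Finset.range j, (1 - PowerSeries.X ^ M * (PowerSeries.X ^ M : ℤ⟦X⟧) ^ l) = x at *
  generalize ∏ l ∈ Finset.range k, (1 - PowerSeries.X ^ M * (PowerSeries.X ^ M : ℤ⟦X⟧) ^ l) = y at *
  generalize ∏ l ∈ Finset.range (j + k),
    (1 - PowerSeries.X ^ M * (PowerSeries.X ^ M : ℤ⟦X⟧) ^ l) = z at *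
  refine ⟨g * p * v + g * y * u - w, ?_⟩
  linear_combination g * p * hv + g * y * hu - hw + h

theorem X_pow_dvd_thetaSeries_sub {a b : ℕ} (ha : 0 < a) (hb : 0 < b) (s : ℤ) (n : ℕ) :
    PowerSeries.X ^ n ∣ thetaSeries s a b -
      ∑ k ∈ Finset.range (n + n + 1), qMono (s * (k - n)) (thetaExp a b (k - n)) := by
  rw [PowerSeries.X_pow_dvd_iff]
  intro d hd
  have h1 := ((PowerSeries.WithPiTopology.hasSum_iff_hasSum_coeff ℤ).mp
    (hasSum_thetaSeries (a := a) (b := b) (by omega) s)) d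
  have h2 : HasSum (fun j : ℤ => PowerSeries.coeff d (qMono (s * j) (thetaExp a b j)))
      (∑ j ∈ (Finset.range (n + n + 1)).image fun k : ℕ => (k : ℤ) - n,
        PowerSeries.coeff d (qMono (s * j) (thetaExp a b j))) := by
    refine hasSum_sum_of_ne_finset_zero fun j hj => ?_
    refine PowerSeries.X_pow_dvd_iff.mp (X_pow_natAbs_dvd_thetaTerm ha hb s j) d ?_
    by_contra hlt
    exact hj (Finset.mem_image.mpr ⟨(j + n).toNat, Finset.mem_range.mpr (by omega), by omega⟩)
  rw [map_sub, h1.unique h2, map_sum, Finset.sum_image (fun x _ y _ h => by simpa using h), sub_self]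

theorem eq_of_X_pow_dvd_sub {f g : ℤ⟦X⟧} (h : ∀ n, PowerSeries.X ^ n ∣ f - g) : f = g := by
  ext d
  have := PowerSeries.X_pow_dvd_iff.mp (h (d + 1)) d d.lt_succ_self
  rwa [map_sub, sub_eq_zero] at this

/-- **Jacobi triple product identity**. -/
theorem thetaSeries_eq_qPochhammerInf {a b : ℕ} (ha : 0 < a) (hb : 0 < b) (s : ℤ) :
    thetaSeries s a b = qPochhammerInf (PowerSeries.X ^ (a + b)) (PowerSeries.X ^ (a + b)) *
      (qPochhammerInf (-qMono s (2 * a)) (PowerSeries.X ^ (a + b)) *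
        qPochhammerInf (-qMono s (2 * b)) (PowerSeries.X ^ (a + b))) := by
  refine eq_of_X_pow_dvd_sub fun n => ?_
  have hM : 0 < a + b := by omega
  have h1 := X_pow_dvd_thetaSeries_sub ha hb s n
  have h2 := X_pow_dvd_qPochhammerInf_sub_prod hM (-qMono s (2 * a)) n
  have h3 := X_pow_dvd_qPochhammerInf_sub_prod hM (-qMono s (2 * b)) n
  have h4 : PowerSeries.X ^ n ∣
      qPochhammerInf (PowerSeries.X ^ (a + b)) (PowerSeries.X ^ (a + b)) * finiteTheta s a b n n -
        ∑ k ∈ Finset.range (n + n + 1), qMono (s * (k - n)) (thetaExp a b (k - n)) := by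
    rw [finiteTheta, Finset.mul_sum, ← Finset.sum_sub_distrib]
    refine Finset.dvd_sum fun k hk => ?_
    obtain ⟨l, hl⟩ := Nat.exists_eq_add_of_le (Nat.lt_succ_iff.mp (Finset.mem_range.mp hk))
    -- Near the ends of the range the binomial is a poor approximation, but the theta term is small
    -- there: since k + l = 2n, the orders min(k, l) and |k - n| add up to n.
    have h5 := X_pow_dvd_qPochhammerInf_mul_gaussBinom_sub_one hM k l (min k l)
      (min_le_left _ _) (min_le_right _ _)
    have h6 := mul_dvd_mul h5 (X_pow_natAbs_dvd_thetaTerm ha hb s (k - n))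
    rw [← pow_add, show min k l + ((k : ℤ) - n).natAbs = n by omega] at h6
    rw [hl]
    refine h6.trans (dvd_of_eq ?_)
    ring
  rw [finiteTheta_eq_prod] at h4
  simp only [neg_mul, sub_neg_eq_add] at h2 h3
  obtain ⟨u, hu⟩ := h1
  obtain ⟨v, hv⟩ := h2
  obtain ⟨w, hw⟩ := h3
  obtain ⟨z, hz⟩ := h4
  generalize qPochhammerInf (-qMono s (2 * a)) (PowerSeries.X ^ (a + b)) = A at *
  generalize qPochhammerInf (-qMono s (2 * b)) (PowerSeries.X ^ (a + b)) = B at *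
  generalize qPochhammerInf (PowerSeries.X ^ (a + b)) (PowerSeries.X ^ (a + b)) = p at *
  generalize ∏ k ∈ Finset.range n, (1 + qMono s (2 * a) * (PowerSeries.X ^ (a + b)) ^ k) = A' at *
  generalize ∏ k ∈ Finset.range n, (1 + qMono s (2 * b) * (PowerSeries.X ^ (a + b)) ^ k) = B' at *
  refine ⟨u - z - p * (v * B + A' * w), ?_⟩
  linear_combination hu - hz - p * (hv * B + A' * hw)

/-! ### Splitting products into residue classes -/

theorem Finset.prod_range_mul_residues {M : Type*} [CommMonoid M] (f : ℕ → M) (k N : ℕ) :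
    ∏ i ∈ Finset.range (k * N), f i =
      ∏ r ∈ Finset.range k, ∏ j ∈ Finset.range N, f (k * j + r) := by
  induction N with
  | zero => simp
  | succ N ih =>
    rw [Nat.mul_succ, Finset.prod_range_add, ih, ← Finset.prod_mul_distrib]
    exact Finset.prod_congr rfl fun r _ => (Finset.prod_range_succ _ N).symm

theorem qPochhammerInf_eq_prod_residues (a : ℤ⟦X⟧) {q : ℤ⟦X⟧}
    (hq : PowerSeries.constantCoeff q = 0) {k : ℕ} (hk : 0 < k) :
    qPochhammerInf a q = ∏ r ∈ Finset.range k, qPochhammerInf (a * q ^ r) (q ^ k) := by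
  have h1 := (multipliable_qPochhammerInf a q hq).hasProd.tendsto_prod_nat.comp
    (Filter.tendsto_id.const_mul_atTop' hk)
  have h2 := tendsto_finsetProd (Finset.range k) fun r _ =>
    (multipliable_qPochhammerInf (a * q ^ r) (q ^ k)
      (by rw [map_pow, hq, zero_pow hk.ne'])).hasProd.tendsto_prod_nat
  refine tendsto_nhds_unique h1 (h2.congr fun N => ?_)
  simp only [Function.comp_apply, id]
  rw [Finset.prod_range_mul_residues]
  refine Finset.prod_congr rfl fun r _ => Finset.prod_congr rfl fun j _ => ?_
  rw [pow_add, pow_mul]; ring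

/-- `(q^i; q^m)_∞`. -/
noncomputable def qPoch (i m : ℕ) : ℤ⟦X⟧ := qPochhammerInf (PowerSeries.X ^ i) (PowerSeries.X ^ m)

theorem qPoch_eq_prod_residues (i : ℕ) {m k : ℕ} (hm : 0 < m) (hk : 0 < k) :
    qPoch i m = ∏ r ∈ Finset.range k, qPoch (i + m * r) (m * k) := by
  rw [qPoch, qPochhammerInf_eq_prod_residues _ (constantCoeff_X_pow_eq_zero hm) hk]
  refine Finset.prod_congr rfl fun r _ => ?_
  rw [qPoch, pow_add, pow_mul, pow_mul]

theorem qPoch_eq_mul {i m : ℕ} (hm : 0 < m) :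
    qPoch i m = (1 - PowerSeries.X ^ i) * qPoch (i + m) m := by
  rw [qPoch, qPochhammerInf_eq_prod_mul _ (constantCoeff_X_pow_eq_zero hm) 1, qPoch, pow_add]
  simp

theorem constantCoeff_qPoch {i m : ℕ} (hi : 0 < i) (hm : 0 < m) :
    PowerSeries.constantCoeff (qPoch i m) = 1 :=
  constantCoeff_qPochhammerInf (constantCoeff_X_pow_eq_zero hm) (constantCoeff_X_pow_eq_zero hi)

theorem thetaSeries_one_eq_qPoch {a b : ℕ} (ha : 0 < a) (hb : 0 < b) :
    thetaSeries 1 a b = qPoch (a + b) (a + b) * (qPoch a (a + b) * qPoch b (a + b)) := by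
  rw [thetaSeries_eq_qPochhammerInf ha hb, qMono_one_left, qMono_one_left, neg_neg, neg_neg]
  rfl

/-- Euler's pentagonal number case: the three factors of the triple product run over the residue
classes of (q^m; q^m)_∞ modulo 3m. -/
theorem thetaSeries_one_self_two_mul {m : ℕ} (hm : 0 < m) :
    thetaSeries 1 m (2 * m) = qPoch m m := by
  rw [thetaSeries_one_eq_qPoch hm (by omega), qPoch_eq_prod_residues m hm (k := 3) (by norm_num)]
  simp only [Finset.prod_range_succ, Finset.prod_range_zero, one_mul, mul_zero, add_zero]
  rw [show m + 2 * m = m * 3 by ring, show m + m * 1 = 2 * m by ring,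
    show m + m * 2 = m * 3 by ring]
  ring

theorem thetaSeries_one_one_two :
    thetaSeries 1 1 2 = (qPoch 1 5 * qPoch 4 5) * (qPoch 2 5 * qPoch 3 5) * qPoch 5 5 := by
  rw [show (2 : ℕ) = 2 * 1 from rfl, thetaSeries_one_self_two_mul one_pos,
    qPoch_eq_prod_residues 1 one_pos (k := 5) (by norm_num)]
  simp only [Finset.prod_range_succ, Finset.prod_range_zero]
  norm_num only
  ring

theorem thetaSeries_one_two_four :
    thetaSeries 1 2 4 = (qPoch 2 10 * qPoch 8 10) * (qPoch 4 10 * qPoch 6 10) * qPoch 10 10 := by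
  rw [show (4 : ℕ) = 2 * 2 from rfl, thetaSeries_one_self_two_mul two_pos,
    qPoch_eq_prod_residues 2 two_pos (k := 5) (by norm_num)]
  simp only [Finset.prod_range_succ, Finset.prod_range_zero]
  norm_num only
  ring

/-! ### Substituting `q ^ 5` for `q` -/

/-- The substitution `q ↦ q ^ 5`. -/
noncomputable def dilate : ℤ⟦X⟧ →ₐ[ℤ] ℤ⟦X⟧ := PowerSeries.expand 5 (by norm_num)

theorem HasSum.dilate {ι : Type*} {f : ι → ℤ⟦X⟧} {S : ℤ⟦X⟧} (h : HasSum f S) :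
    HasSum (fun i => dilate (f i)) (dilate S) := by
  rw [PowerSeries.WithPiTopology.hasSum_iff_hasSum_coeff] at h ⊢
  intro d
  simp only [_root_.dilate, PowerSeries.coeff_expand]
  split_ifs
  · exact h (d / 5)
  · exact hasSum_zero

theorem dilate_qMono (k : ℤ) {P : ℤ} (hP : P % 2 = 0) : dilate (qMono k P) = qMono k (5 * P) := by
  rw [qMono, dilate, PowerSeries.expand_monomial, qMono]
  congr 1
  congr 1
  omega

theorem dilate_thetaSeries {a b : ℕ} (h : 0 < a + b) (s : ℤ) :
    dilate (thetaSeries s a b) = thetaSeries s (5 * a) (5 * b) := by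
  refine ((hasSum_thetaSeries h s).dilate).unique
    ((hasSum_thetaSeries (a := 5 * a) (b := 5 * b) (by omega) s).congr_fun fun n => ?_)
  rw [dilate_qMono _ (thetaExp_emod_two a b n)]
  congr 1
  simp only [thetaExp]
  push_cast
  ring

theorem dilate_X : dilate PowerSeries.X = PowerSeries.X ^ 5 := PowerSeries.expand_X _ _

theorem coeff_X_pow_mul_dilate (n : ℕ) {r s : ℕ} (hr : r < 5) (hs : s < 5) (f : ℤ⟦X⟧) :
    PowerSeries.coeff (5 * n + r) (PowerSeries.X ^ s * dilate f) =
      if r = s then PowerSeries.coeff n f else 0 := by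
  rw [PowerSeries.coeff_X_pow_mul', dilate, PowerSeries.coeff_expand]
  by_cases h : r = s
  · subst h
    rw [if_pos (by omega), if_pos (by omega), if_pos rfl, Nat.add_sub_cancel,
      Nat.mul_div_cancel_left n (by norm_num)]
  · rw [if_neg h]
    split_ifs <;> first | rfl | omega

/-! ### Dissection of the generating function -/

/-- The multiplier E_5² E_10 supplies the factors missing from the triple products; being a series
in q⁵, it does not disturb the dissection. -/
theorem g₁Series_mul :
    g₁Series * (thetaSeries 1 5 10 ^ 2 * thetaSeries 1 10 20) =
      thetaSeries 0 1 4 ^ 2 * thetaSeries 1 6 4 := by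
  rw [show (10 : ℕ) = 2 * 5 from rfl, thetaSeries_one_self_two_mul (by norm_num),
    show (20 : ℕ) = 2 * (2 * 5) from rfl, thetaSeries_one_self_two_mul (by norm_num),
    thetaSeries_eq_qPochhammerInf (a := 1) (b := 4) (by norm_num) (by norm_num),
    thetaSeries_one_eq_qPoch (a := 6) (b := 4) (by norm_num) (by norm_num),
    qMono_zero_left, qMono_zero_left, g₁Series, pow_one]
  simp only [qPoch]
  norm_num only
  ring

/-- f(q⁵, q⁵) and f(q¹⁰, 1) are already series in q⁵, so only their cofactors need splitting. Each
class pairs one term from each of the two splittings into a bracket. -/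
theorem thetaSeries_sq_mul_eq_dilate :
    thetaSeries 0 1 4 ^ 2 * thetaSeries 1 6 4 =
      dilate (thetaSeries 1 6 4 * (thetaSeries 1 1 2 *
        (thetaSeries 1 7 8 + PowerSeries.X * thetaSeries 1 13 2))) +
      PowerSeries.X * dilate (thetaSeries 1 6 4 * (2 * (thetaSeries 1 5 10 * thetaSeries 1 1 2))) +
      PowerSeries.X ^ 2 * dilate (thetaSeries 1 8 2 * (thetaSeries 1 1 2 *
        (thetaSeries 1 7 8 + PowerSeries.X * thetaSeries 1 13 2))) +
      PowerSeries.X ^ 4 * dilate (thetaSeries 1 8 2 * (thetaSeries 1 1 2 *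
        (thetaSeries 1 11 4 - PowerSeries.X * thetaSeries 1 14 1))) := by
  rw [← thetaSeries_bracket_zero, ← thetaSeries_bracket_one, ← thetaSeries_bracket_four]
  simp only [map_mul, map_sub, dilate_X]
  rw [dilate_thetaSeries (a := 6) (b := 4) (by norm_num),
    dilate_thetaSeries (a := 6) (b := 4) (by norm_num),
    dilate_thetaSeries (a := 1) (b := 1) (by norm_num),
    dilate_thetaSeries (a := 2) (b := 0) (by norm_num),
    dilate_thetaSeries (a := 9) (b := 1) (by norm_num),
    dilate_thetaSeries (a := 5) (b := 5) (by norm_num),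
    dilate_thetaSeries (a := 10) (b := 0) (by norm_num),
    dilate_thetaSeries (a := 8) (b := 2) (by norm_num),
    dilate_thetaSeries (a := 8) (b := 2) (by norm_num),
    dilate_thetaSeries (a := 7) (b := 3) (by norm_num)]
  norm_num only
  have h1 := thetaSeries_sq_one_four
  have h2 := thetaSeries_eight_two_mul_six_four
  have h3 := thetaSeries_seven_three_mul_six_four
  rw [thetaSeries_comm 1 20 30, thetaSeries_comm 0 20 30, thetaSeries_comm 0 10 40,
    thetaSeries_comm 1 10 40] at h2
  rw [thetaSeries_comm 1 10 40, thetaSeries_comm 1 20 30, thetaSeries_comm 0 5 45] at h3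
  rw [thetaSeries_comm 0 2 8] at h1
  linear_combination thetaSeries 1 6 4 * h1 + thetaSeries 0 5 5 * h2 +
    PowerSeries.X * thetaSeries 0 10 0 * h3

theorem exists_mul_eq_one {f : ℤ⟦X⟧} (hf : PowerSeries.constantCoeff f = 1) : ∃ g, g * f = 1 :=
  (PowerSeries.isUnit_iff_constantCoeff.mpr (hf ▸ isUnit_one)).exists_left_inv

theorem ne_zero_of_constantCoeff {f : ℤ⟦X⟧} (hf : PowerSeries.constantCoeff f = 1) : f ≠ 0 := by
  rintro rfl
  simp at hf

/-- The `5`-dissection of the generating function of `g₁`. -/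
theorem exists_dissection : ∃ C₀ C₁ C₂ C₄ : ℤ⟦X⟧,
    C₀ * ((qPoch 1 5 * qPoch 4 5) ^ 2 * (qPoch 2 10 * qPoch 8 10)) = 1 ∧
    C₁ * ((qPoch 1 5 * qPoch 4 5) * (qPoch 2 5 * qPoch 3 5) * (qPoch 2 10 * qPoch 8 10)) = 2 ∧
    C₂ * ((qPoch 1 5 * qPoch 4 5) ^ 2 * (qPoch 4 10 * qPoch 6 10)) = 1 ∧
    C₄ * ((qPoch 2 5 * qPoch 3 5) ^ 2 * (qPoch 4 10 * qPoch 6 10)) = 1 ∧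
    g₁Series = dilate C₀ + PowerSeries.X * dilate C₁ + PowerSeries.X ^ 2 * dilate C₂ +
      PowerSeries.X ^ 4 * dilate C₄ := by
  have hc : ∀ {i m : ℕ}, 0 < i → 0 < m → PowerSeries.constantCoeff (qPoch i m) = 1 :=
    constantCoeff_qPoch
  obtain ⟨C₀, h₀⟩ := exists_mul_eq_one
    (f := (qPoch 1 5 * qPoch 4 5) ^ 2 * (qPoch 2 10 * qPoch 8 10)) (by simp [hc])
  obtain ⟨C₁, h₁⟩ := exists_mul_eq_one
    (f := (qPoch 1 5 * qPoch 4 5) * (qPoch 2 5 * qPoch 3 5) * (qPoch 2 10 * qPoch 8 10))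
    (by simp [hc])
  obtain ⟨C₂, h₂⟩ := exists_mul_eq_one
    (f := (qPoch 1 5 * qPoch 4 5) ^ 2 * (qPoch 4 10 * qPoch 6 10)) (by simp [hc])
  obtain ⟨C₄, h₄⟩ := exists_mul_eq_one
    (f := (qPoch 2 5 * qPoch 3 5) ^ 2 * (qPoch 4 10 * qPoch 6 10)) (by simp [hc])
  refine ⟨C₀, 2 * C₁, C₂, C₄, h₀, by linear_combination 2 * h₁, h₂, h₄, ?_⟩
  have hE := thetaSeries_one_one_two
  have hE2 := thetaSeries_one_two_four
  have hE5 := thetaSeries_one_self_two_mul (m := 5) (by norm_num)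
  have t41 := thetaSeries_one_eq_qPoch (a := 4) (b := 1) (by norm_num) (by norm_num)
  have t32 := thetaSeries_one_eq_qPoch (a := 3) (b := 2) (by norm_num) (by norm_num)
  have t64 := thetaSeries_one_eq_qPoch (a := 6) (b := 4) (by norm_num) (by norm_num)
  have t82 := thetaSeries_one_eq_qPoch (a := 8) (b := 2) (by norm_num) (by norm_num)
  norm_num only at hE5 t41 t32 t64 t82
  have q14 := thetaSeries_quintuple_one_four
  have q23 := thetaSeries_quintuple_two_three
  rw [t41, t32, thetaSeries_comm 1 10 5, hE5, thetaSeries_comm 1 8 7] at q14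
  rw [t41, t32, thetaSeries_comm 1 10 5, hE5, thetaSeries_comm 1 4 11] at q23
  have hD : PowerSeries.constantCoeff (thetaSeries 1 1 2 ^ 2 * thetaSeries 1 2 4) = 1 := by
    rw [hE, hE2]; simp [hc]
  have key := g₁Series_mul.trans thetaSeries_sq_mul_eq_dilate
  have e1 := dilate_thetaSeries (a := 1) (b := 2) (by norm_num) 1
  have e2 := dilate_thetaSeries (a := 2) (b := 4) (by norm_num) 1
  norm_num only at e1 e2
  -- The first rewrite also hits the copy of `thetaSeries 1 5 10` inside class 1; the final `e1`
  -- restores it.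
  rw [← e1, ← e2, ← map_pow, ← map_mul, e1] at key
  have hf : qPoch 5 5 ≠ 0 := ne_zero_of_constantCoeff (hc (by norm_num) (by norm_num))
  generalize thetaSeries 1 7 8 + PowerSeries.X * thetaSeries 1 13 2 = Q₀ at *
  generalize thetaSeries 1 11 4 - PowerSeries.X * thetaSeries 1 14 1 = Q₄ at *
  -- The quintuple product identities, with a common (q⁵; q⁵)_∞ cancelled, evaluate the cofactors
  -- `Q₀` and `Q₄`.
  have n14 : qPoch 1 5 * qPoch 4 5 * Q₀ = qPoch 2 5 * qPoch 3 5 * qPoch 5 5 :=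
    mul_left_cancel₀ hf (by linear_combination q14)
  have n23 : qPoch 2 5 * qPoch 3 5 * Q₄ = qPoch 1 5 * qPoch 4 5 * qPoch 5 5 :=
    mul_left_cancel₀ hf (by linear_combination q23)
  have hN₀ : thetaSeries 1 6 4 * (thetaSeries 1 1 2 * Q₀) =
      C₀ * (thetaSeries 1 1 2 ^ 2 * thetaSeries 1 2 4) := by
    rw [t64, hE, hE2]
    linear_combination qPoch 10 10 * (qPoch 4 10 * qPoch 6 10) * (qPoch 2 5 * qPoch 3 5) * qPoch 5 5 * n14 -
      qPoch 10 10 * (qPoch 4 10 * qPoch 6 10) * (qPoch 2 5 * qPoch 3 5) ^ 2 * qPoch 5 5 ^ 2 * h₀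
  have hN₁ : thetaSeries 1 6 4 * (2 * (thetaSeries 1 5 10 * thetaSeries 1 1 2)) =
      2 * C₁ * (thetaSeries 1 1 2 ^ 2 * thetaSeries 1 2 4) := by
    rw [t64, hE5, hE, hE2]
    linear_combination -2 * qPoch 10 10 * (qPoch 4 10 * qPoch 6 10) * qPoch 5 5 ^ 2 *
      (qPoch 1 5 * qPoch 4 5) * (qPoch 2 5 * qPoch 3 5) * h₁
  have hN₂ : thetaSeries 1 8 2 * (thetaSeries 1 1 2 * Q₀) =
      C₂ * (thetaSeries 1 1 2 ^ 2 * thetaSeries 1 2 4) := by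
    rw [t82, hE, hE2]
    linear_combination qPoch 10 10 * (qPoch 2 10 * qPoch 8 10) * (qPoch 2 5 * qPoch 3 5) * qPoch 5 5 * n14 -
      qPoch 10 10 * (qPoch 2 10 * qPoch 8 10) * (qPoch 2 5 * qPoch 3 5) ^ 2 * qPoch 5 5 ^ 2 * h₂
  have hN₄ : thetaSeries 1 8 2 * (thetaSeries 1 1 2 * Q₄) =
      C₄ * (thetaSeries 1 1 2 ^ 2 * thetaSeries 1 2 4) := by
    rw [t82, hE, hE2]
    linear_combination qPoch 10 10 * (qPoch 2 10 * qPoch 8 10) * (qPoch 1 5 * qPoch 4 5) * qPoch 5 5 * n23 -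
      qPoch 10 10 * (qPoch 2 10 * qPoch 8 10) * (qPoch 1 5 * qPoch 4 5) ^ 2 * qPoch 5 5 ^ 2 * h₄
  rw [hN₀, hN₁, hN₂, hN₄] at key
  have hD' : dilate (thetaSeries 1 1 2 ^ 2 * thetaSeries 1 2 4) ≠ 0 := by
    refine ne_zero_of_constantCoeff ?_
    rw [dilate, PowerSeries.constantCoeff_expand, hD]
  refine mul_right_cancel₀ hD' ?_
  rw [key]
  simp only [map_mul]
  ring

/-! ### Positivity -/

/-- Division by 1 - q^d adds the coefficient d places earlier. The bound k < n lets infinite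
products be replaced by truncations. -/
theorem coeff_nonneg_of_mul_one_sub {f : ℤ⟦X⟧} {d n : ℕ} (hd : 0 < d)
    (h : ∀ k < n, 0 ≤ PowerSeries.coeff k (f * (1 - PowerSeries.X ^ d))) :
    ∀ k < n, 0 ≤ PowerSeries.coeff k f := by
  intro k
  induction k using Nat.strong_induction_on with
  | _ k ih =>
    intro hk
    have h1 := h k hk
    rw [mul_sub, mul_one, map_sub, PowerSeries.coeff_mul_X_pow'] at h1
    split_ifs at h1 with hdk
    · have := ih (k - d) (by omega) (by omega)
      omega
    · omega

theorem coeff_nonneg_of_mul_prod {f : ℤ⟦X⟧} {i m n : ℕ} (hi : 0 < i) (N : ℕ)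
    (h : ∀ k < n, 0 ≤ PowerSeries.coeff k
      (f * ∏ l ∈ Finset.range N, (1 - PowerSeries.X ^ i * (PowerSeries.X ^ m) ^ l))) :
    ∀ k < n, 0 ≤ PowerSeries.coeff k f := by
  induction N with
  | zero => simpa using h
  | succ N ih =>
    refine ih (coeff_nonneg_of_mul_one_sub (d := i + m * N) (by omega) ?_)
    rw [Finset.prod_range_succ, ← mul_assoc, ← pow_mul, ← pow_add] at h
    exact h

theorem coeff_nonneg_of_mul_qPoch {f : ℤ⟦X⟧} {i m : ℕ} (hi : 0 < i) (hm : 0 < m)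
    (h : ∀ k, 0 ≤ PowerSeries.coeff k (f * qPoch i m)) : ∀ k, 0 ≤ PowerSeries.coeff k f := by
  intro n
  refine coeff_nonneg_of_mul_prod (n := n + 1) (m := m) hi (n + 1) (fun k hk => ?_) n n.lt_succ_self
  have h1 := (X_pow_dvd_qPochhammerInf_sub_prod hm (PowerSeries.X ^ i) (n + 1)).mul_left f
  have h2 := PowerSeries.X_pow_dvd_iff.mp h1 k hk
  rw [mul_sub, map_sub, sub_eq_zero] at h2
  rw [← h2]
  exact h k

theorem coeff_pos_of_mul_one_sub_X {f : ℤ⟦X⟧}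
    (h : ∀ k, 0 ≤ PowerSeries.coeff k (f * (1 - PowerSeries.X)))
    (h0 : 0 < PowerSeries.constantCoeff f) (n : ℕ) : 0 < PowerSeries.coeff n f := by
  induction n with
  | zero => simpa using h0
  | succ n ih =>
    have h1 := h (n + 1)
    rw [mul_sub, mul_one, map_sub, PowerSeries.coeff_succ_mul_X] at h1
    omega

/-- Dividing by 1 - q² makes coefficients increase in steps of 2, so positivity spreads from the
indices 0 and 3. -/
theorem coeff_pos_of_mul_one_sub_X_sq_mul_one_sub_X_cube {f : ℤ⟦X⟧}
    (h : ∀ k, 0 ≤ PowerSeries.coeff k (f * (1 - PowerSeries.X ^ 2) * (1 - PowerSeries.X ^ 3)))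
    (h0 : 0 < PowerSeries.constantCoeff f) {n : ℕ} (hn : n ≠ 1) : 0 < PowerSeries.coeff n f := by
  have hg := fun k => coeff_nonneg_of_mul_one_sub (n := k + 1) (by norm_num)
    (fun l _ => h l) k k.lt_succ_self
  have hf := fun k => coeff_nonneg_of_mul_one_sub (n := k + 1) (by norm_num)
    (fun l _ => hg l) k k.lt_succ_self
  have hstep : ∀ k, PowerSeries.coeff k f ≤ PowerSeries.coeff (k + 2) f := fun k => by
    have h1 := hg (k + 2)
    rw [mul_sub, mul_one, map_sub, PowerSeries.coeff_mul_X_pow] at h1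
    omega
  have hz : 0 < PowerSeries.coeff 0 f := by simpa using h0
  have hthree : 0 < PowerSeries.coeff 3 f := by
    -- In degree 3 the hypothesis reads f₃ ≥ f₁ + f₀.
    have h1 := h 3
    rw [mul_sub, mul_one, map_sub, mul_sub, mul_one, sub_mul, map_sub, map_sub,
      PowerSeries.coeff_mul_X_pow', PowerSeries.coeff_mul_X_pow', PowerSeries.coeff_mul_X_pow',
      PowerSeries.coeff_mul_X_pow'] at h1
    have h2 := hf 1
    norm_num at h1 hz
    omega
  induction n using Nat.strong_induction_on with
  | _ n ih =>
    rcases n with - | - | - | - | n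
    · exact hz
    · exact absurd rfl hn
    · exact hz.trans_le (hstep 0)
    · exact hthree
    · exact (ih (n + 2) (by omega) (by omega)).trans_le (hstep (n + 2))

theorem coeff_natCast_nonneg (c k : ℕ) : 0 ≤ PowerSeries.coeff k (c : ℤ⟦X⟧) := by
  rw [← map_natCast (PowerSeries.C (R := ℤ)), PowerSeries.coeff_C]
  split_ifs <;> positivity

/-- The product of `(q^i; q^m)_∞` over the pairs `(i, m)` of a list. -/
noncomputable def qPochList (L : List (ℕ × ℕ)) : ℤ⟦X⟧ := (L.map fun p => qPoch p.1 p.2).prod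

theorem coeff_nonneg_of_mul_qPochList {L : List (ℕ × ℕ)} (hL : ∀ p ∈ L, 0 < p.1 ∧ 0 < p.2)
    {f : ℤ⟦X⟧} (h : ∀ k, 0 ≤ PowerSeries.coeff k (f * qPochList L)) :
    ∀ k, 0 ≤ PowerSeries.coeff k f := by
  induction L generalizing f with
  | nil => simpa [qPochList] using h
  | cons p L ih =>
    rw [List.forall_mem_cons] at hL
    refine coeff_nonneg_of_mul_qPoch hL.1.1 hL.1.2 (ih hL.2 ?_)
    simpa only [qPochList, List.map_cons, List.prod_cons, mul_assoc] using h

theorem constantCoeff_qPochList {L : List (ℕ × ℕ)} (hL : ∀ p ∈ L, 0 < p.1 ∧ 0 < p.2) :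
    PowerSeries.constantCoeff (qPochList L) = 1 := by
  induction L with
  | nil => simp [qPochList]
  | cons p L ih =>
    rw [List.forall_mem_cons] at hL
    have := ih hL.2
    rw [qPochList] at this
    rw [qPochList, List.map_cons, List.prod_cons, map_mul, this,
      constantCoeff_qPoch hL.1.1 hL.1.2, one_mul]

theorem coeff_pos_of_mul_qPochList {f : ℤ⟦X⟧} {c : ℕ} (hc : 0 < c) {L : List (ℕ × ℕ)}
    (hL : ∀ p ∈ L, 0 < p.1 ∧ 0 < p.2) (h : f * (1 - PowerSeries.X) * qPochList L = (c : ℤ⟦X⟧))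
    (n : ℕ) : 0 < PowerSeries.coeff n f := by
  refine coeff_pos_of_mul_one_sub_X (coeff_nonneg_of_mul_qPochList hL fun k => ?_) ?_ n
  · rw [h]
    exact coeff_natCast_nonneg c k
  · have := congrArg PowerSeries.constantCoeff h
    rw [map_mul, map_mul, constantCoeff_qPochList hL, map_natCast] at this
    simp at this
    omega

theorem mainTheorem5 (n : ℕ) :
    0 < g₁ (5 * n) ∧
    0 < g₁ (5 * n + 1) ∧
    0 < g₁ (5 * n + 2) ∧
    (0 < g₁ (5 * n + 4) ↔ n ≠ 1) := by
  obtain ⟨C₀, C₁, C₂, C₄, h₀, h₁, h₂, h₄, hg⟩ := exists_dissection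
  have hcoeff : ∀ r < 5, g₁ (5 * n + r) =
      (if r = 0 then PowerSeries.coeff n C₀ else 0) + (if r = 1 then PowerSeries.coeff n C₁ else 0) +
      (if r = 2 then PowerSeries.coeff n C₂ else 0) +
      (if r = 4 then PowerSeries.coeff n C₄ else 0) := by
    intro r hr
    have h0 := coeff_X_pow_mul_dilate n hr (s := 0) (by norm_num) C₀
    have h1 := coeff_X_pow_mul_dilate n hr (s := 1) (by norm_num) C₁
    rw [pow_zero, one_mul] at h0
    rw [pow_one] at h1
    rw [g₁, hg, map_add, map_add, map_add, h0, h1, coeff_X_pow_mul_dilate n hr (by norm_num),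
      coeff_X_pow_mul_dilate n hr (by norm_num)]
  have e0 : g₁ (5 * n) = PowerSeries.coeff n C₀ := by simpa using hcoeff 0 (by norm_num)
  have e1 : g₁ (5 * n + 1) = PowerSeries.coeff n C₁ := by simpa using hcoeff 1 (by norm_num)
  have e2 : g₁ (5 * n + 2) = PowerSeries.coeff n C₂ := by simpa using hcoeff 2 (by norm_num)
  have e4 : g₁ (5 * n + 4) = PowerSeries.coeff n C₄ := by simpa using hcoeff 4 (by norm_num)
  have h15 : qPoch 1 5 = (1 - PowerSeries.X) * qPoch 6 5 := by
    simpa using qPoch_eq_mul (i := 1) (m := 5) (by norm_num)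
  have h25 : qPoch 2 5 = (1 - PowerSeries.X ^ 2) * qPoch 7 5 := qPoch_eq_mul (by norm_num)
  have h35 : qPoch 3 5 = (1 - PowerSeries.X ^ 3) * qPoch 8 5 := qPoch_eq_mul (by norm_num)
  rw [e0, e1, e2, e4]
  refine ⟨?_, ?_, ?_, ?_⟩
  -- One factor 1 - q is taken out of (q; q⁵)_∞, leaving (q⁶; q⁵)_∞ in the list.
  · refine coeff_pos_of_mul_qPochList (c := 1) one_pos
      (L := [(6, 5), (1, 5), (4, 5), (4, 5), (2, 10), (8, 10)]) (by simp) ?_ n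
    refine Eq.trans ?_ (h₀.trans Nat.cast_one.symm)
    simp only [qPochList, List.map_cons, List.map_nil, List.prod_cons, List.prod_nil]
    rw [h15]
    ring
  · refine coeff_pos_of_mul_qPochList (c := 2) two_pos
      (L := [(6, 5), (4, 5), (2, 5), (3, 5), (2, 10), (8, 10)]) (by simp) ?_ n
    rw [Nat.cast_two, ← h₁, h15]
    simp only [qPochList, List.map_cons, List.map_nil, List.prod_cons, List.prod_nil]
    ring
  · refine coeff_pos_of_mul_qPochList (c := 1) one_pos
      (L := [(6, 5), (1, 5), (4, 5), (4, 5), (4, 10), (6, 10)]) (by simp) ?_ n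
    refine Eq.trans ?_ (h₂.trans Nat.cast_one.symm)
    simp only [qPochList, List.map_cons, List.map_nil, List.prod_cons, List.prod_nil]
    rw [h15]
    ring
  · have hL : ∀ p ∈ [(7, 5), (8, 5), (2, 5), (3, 5), (4, 10), (6, 10)],
      0 < p.1 ∧ 0 < p.2 := by simp
    have hfac : C₄ * (1 - PowerSeries.X ^ 2) * (1 - PowerSeries.X ^ 3) *
        qPochList [(7, 5), (8, 5), (2, 5), (3, 5), (4, 10), (6, 10)] = 1 := by
      refine Eq.trans ?_ h₄
      simp only [qPochList, List.map_cons, List.map_nil, List.prod_cons, List.prod_nil]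
      rw [h25, h35]
      ring
    constructor
    -- Every factor of the denominator of `C₄` is 1 modulo q², hence so is `C₄`, and its coefficient
    -- of q is 0.
    · rintro hpos rfl
      have hd : ∀ {i m : ℕ}, 2 ≤ i → 0 < m → PowerSeries.X ^ 2 ∣ qPoch i m - 1 := fun hi hm =>
        X_pow_dvd_qPochhammerInf_sub_one (constantCoeff_X_pow_eq_zero hm) (pow_dvd_pow _ hi)
      have hmul : ∀ {f g : ℤ⟦X⟧}, PowerSeries.X ^ 2 ∣ f - 1 → PowerSeries.X ^ 2 ∣ g - 1 →
          PowerSeries.X ^ 2 ∣ f * g - 1 := fun {f g} hf hg => by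
        rw [show f * g - 1 = (f - 1) * g + (g - 1) by ring]
        exact dvd_add (hf.mul_right g) hg
      have h23 : (PowerSeries.X : ℤ⟦X⟧) ^ 2 ∣ qPoch 2 5 * qPoch 3 5 - 1 :=
        hmul (hd (by norm_num) (by norm_num)) (hd (by norm_num) (by norm_num))
      have hw := (hmul (hmul h23 h23) (hmul (hd (i := 4) (m := 10) (by norm_num) (by norm_num))
        (hd (i := 6) (m := 10) (by norm_num) (by norm_num)))).mul_left C₄
      have hdvd : PowerSeries.X ^ 2 ∣ C₄ - 1 := by
        rw [← dvd_neg]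
        refine hw.trans (dvd_of_eq ?_)
        linear_combination h₄
      have := PowerSeries.X_pow_dvd_iff.mp hdvd 1 (by norm_num)
      rw [map_sub, PowerSeries.coeff_one, if_neg one_ne_zero, sub_zero] at this
      omega
    · refine coeff_pos_of_mul_one_sub_X_sq_mul_one_sub_X_cube
        (coeff_nonneg_of_mul_qPochList hL fun k => ?_) ?_
      · rw [hfac]
        simpa using coeff_natCast_nonneg 1 k
      · have := congrArg PowerSeries.constantCoeff hfac
        rw [map_mul, constantCoeff_qPochList hL] at this
        simp at this
        omega
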